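/- **Setting.** Let $b_s>0$, $\Omega_{sr}\ge 0$, $\Gamma_s\in\{1,2,\dots\}$, $\bar\gamma_{SR},\bar\gamma_{RU},m,m_s,\Omega_s,\Omega_m,C>0$ and $B,T,\theta>0$, and put $\beta=BT\theta/\log 2$, $$\alpha_{SR}=\frac1{2b_s}\Big(\frac{2b_s\Gamma_s}{2b_s\Gamma_s+\Omega_{sr}}\Big)^{\Gamma_s},\quad \beta_{SR}=\frac1{2b_s},\quad \delta_{SR}=\frac{\Omega_{sr}}{2b_s(2b_s\Gamma_s+\Omega_{sr})},\quad c_k=\frac{(-1)^k(1-\Gamma_s)_{k}\,\delta_{SR}^k}{(k!)^2},$$ $$r=\frac{\beta_{SR}-\delta_{SR}}{\bar\gamma_{SR}},\qquad A=\frac{m\Omega_s}{m_s\Omega_m\bar\gamma_{RU}},\qquad \mathrm B(a,b)=\frac{\Gamma(a)\Gamma(b)}{\Gamma(a+b)}.$$ Let $h_{SR},h_{RU}$ be independent complex random variables such that $|h_{SR}|^2$ has density $f(x)=\alpha_{SR}e^{-\beta_{SR}x}{}_1F_1(\Gamma_s;1;\delta_{SR}x)$ and $|h_{RU}|$ has density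 $\dfrac{2(m\Omega_s)^m(m_s\Omega_m)^{m_s}x^{2m-1}}{\mathrm B(m,m_s)(m\Omega_sx^2+m_s\Omega_m)^{m+m_s}}$ on $x>0$. Put $\gamma_{SR}=\bar\gamma_{SR}|h_{SR}|^2$, $\gamma_{RU}=\bar\gamma_{RU}|h_{RU}|^2$, $\gamma_{AF}=\dfrac{\gamma_{SR}\gamma_{RU}}{\gamma_{RU}+C}$, $\gamma_{DF}=\min\{\gamma_{SR},\gamma_{RU}\}$; write $F_\bullet$ for the distribution functions. For $\gamma\in\{\gamma_{SR},\gamma_{RU},\gamma_{AF},\gamma_{DF}\}$ the effective capacity is $E_C(\theta)=-\frac1\theta\log\mathbb E[e^{-\theta R}]$ with $R=BT\log_2(1+\gamma)$. The Meijer function $G^{\mu,\nu}_{p,q}\big(z\,\big|\,{a_1,\dots,a_p\atop b_1,\dots,b_q}\big)$ is $\frac1{2\pi i}\int\Phi(s)z^s\,ds$ with $\Phi(s)=\frac{\prod_{j\le\mu}\Gamma(b_j-s)\prod_{j\le\nu}\Gamma(1-a_j+s)}{\prod_{j>\mu}\Gamma(1-b_j+s)\prod_{j>\nu}\Gamma(a_j-s)}$,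 along a vertical line that has the poles of the $\Gamma(b_j-s)$, $j\le\mu$, on its right and those of the $\Gamma(1-a_j+s)$, $j\le\nu$, on its left. The bivariate function $G(\cdot\,|\,\cdot\,|\,\cdot\,|\,z,w)$ with three parameter blocks is $\frac1{(2\pi i)^2}\iint\Phi_0(s+t)\Phi_1(s)\Phi_2(t)z^sw^t\,ds\,dt$ along vertical lines $\mathrm{Re}\,s=\sigma_1$, $\mathrm{Re}\,t=\sigma_2$ such that $\sigma_1+\sigma_2,\sigma_1,\sigma_2$ separate the poles of the respective blocks. ${}_2F_1$ is given on $(-\infty,1)$ by Euler's integral. **Claim.** For all the Meijer functions below such lines exist, and on all of them the integrals converge absolutely, with a value that does not depend on the lines. The variables $\gamma_{SR},\gamma_{RU}$ have on $(0,\infty)$ the densities $f_{SR}(x)=\bar\gamma_{SR}^{-1}f(x/\bar\gamma_{SR})$ and $f_{RU}(x)=\dfrac{(m\Omega_s)^m(m_s\Omega_m\bar\gamma_{RU})^{m_s}x^{m-1}}{\mathrm B(m,m_s)(m\Omega_sx+m_s\Omega_m\bar\gamma_{RU})^{m+m_s}}$. In each of the four cases $E_C(\theta)=-\frac1\theta\log\mathbb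 E[(1+\gamma)^{-\beta}]$, and moreover: 1. (S-R link) $E_C^{SR}(\theta)=-\frac1\theta\log S$ with $$S=\frac{\alpha_{SR}}{\Gamma(\beta)}\sum_{k=0}^{\Gamma_s-1}\frac{c_k}{\bar\gamma_{SR}^{k+1}}\,G^{2,1}_{1,2}\Big(r\,\Big|\,{-k\atop \beta-k-1,\,0}\Big).$$ 2. (R-U link) $E_C^{RU}(\theta)=-\frac1\theta\log U$ with $$U=\frac1{\Gamma(m)\Gamma(m_s)\Gamma(\beta)}\,G^{2,2}_{2,2}\Big(A\,\Big|\,{1,\,1-m_s\atop \beta,\,m}\Big).$$ 3. (Fixed-gain AF relay) $E_C^{AF}(\theta)=-\frac1\theta\log\Big(\beta\int_0^\infty\frac{F_{AF}(x)}{(1+x)^{\beta+1}}dx\Big)=-\frac1\theta\log\big(\beta(M_1+M_2)\big)$, where, with $\mathcal L(x)=\int_0^\infty F_{RU}(Cx/y)f_{SR}(y+x)\,dy$ and all integrals convergent, $$M_1=\int_0^\infty\frac{F_{SR}(x)}{(1+x)^{\beta+1}}dx=\sum_{k=0}^{\Gamma_s-1}\frac{\alpha_{SR}c_k}{(\beta_{SR}-\delta_{SR})^{k+1}}\Big[\frac{\Gamma(k+1)}{\beta}-\frac1{\Gamma(\beta+1)}G^{3,1}_{2,3}\Big(r\,\Big|\,{0,\,1\atop\beta,\,0,\,k+1}\Big)\Big],$$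 $$M_2=\int_0^\infty\frac{\mathcal L(x)}{(1+x)^{\beta+1}}dx=\sum_{k=0}^{\Gamma_s-1}\frac{d_k}{\Gamma(\beta+1)}\sum_{i=0}^k\binom ki\,G^{1,1:1,0:2,2}_{1,1:0,1:2,3}\Big({0\atop\beta}\Big|{-\atop k-i}\Big|{1-m_s,\,1\atop m,\,1+i,\,0}\Big|\,r,\;rAC\Big),$$ with $d_k=\dfrac{\alpha_{SR}c_k}{\Gamma(m)\Gamma(m_s)(\beta_{SR}-\delta_{SR})^{k+1}}$. 4. (DF relay) $E_C^{DF}(\theta)=-\frac1\theta\log(N-N_1-N_2)$, where, all integrals being convergent, $N=\int_0^\infty\frac{f_{SR}(x)+f_{RU}(x)}{(1+x)^\beta}dx=S+U$, $$N_1=\int_0^\infty\frac{f_{SR}(x)F_{RU}(x)}{(1+x)^\beta}dx=\sum_{k=0}^{\Gamma_s-1}\frac{\alpha_{SR}c_k}{\Gamma(m)\Gamma(m_s)\Gamma(\beta)\bar\gamma_{SR}^{k+1}}\,G^{1,1:1,0:1,2}_{1,1:0,1:2,2}\Big({-k\atop\beta-k-1}\Big|{-\atop0}\Big|{1-m_s,\,1\atop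 m,\,0}\Big|\,r,\;A\Big),$$ $$\begin{aligned}N_2=\int_0^\infty\frac{f_{RU}(x)F_{SR}(x)}{(1+x)^\beta}dx=\sum_{k=0}^{\Gamma_s-1}g_k\Big[&\Gamma(k+1)\mathrm B(m,m_s+\beta)\,{}_2F_1(m+m_s,m;m+m_s+\beta;1-A)\\&-\frac1{\Gamma(m+m_s)\Gamma(\beta)}G^{1,1:1,1:2,0}_{1,1:1,1:1,2}\Big({1-m\atop\beta-m}\Big|{1-m-m_s\atop0}\Big|{1\atop0,\,k+1}\Big|\,A,\;r\Big)\Big],\end{aligned}$$ with $g_k=\dfrac{\alpha_{SR}c_kA^m}{\mathrm B(m,m_s)(\beta_{SR}-\delta_{SR})^{k+1}}$. -/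

import Mathlib

open MeasureTheory ProbabilityTheory

noncomputable section

/-! ### Special functions -/

/-- The confluent hypergeometric function `₁F₁(a; b; x) = ∑ (a)ₙ / (b)ₙ · xⁿ / n!`. -/
def hyp1F1 (a b x : ℝ) : ℝ :=
  ∑' n : ℕ, (ascPochhammer ℝ n).eval a / (ascPochhammer ℝ n).eval b * (x ^ n / (n.factorial : ℝ))

/-- The Gauss hypergeometric function `₂F₁(a, b; c; z)` for `0 < b < c` and real `z < 1`, by
Euler's integral. This is the analytic continuation of the Gauss series from `|z| < 1` to all
real `z < 1`; it is needed there since the argument `1 - A` below may be smaller than `-1`. -/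
def hyp2F1 (a b c z : ℝ) : ℝ :=
  1 / beta b (c - b) *
    ∫ t in (0 : ℝ)..1, t ^ (b - 1) * (1 - t) ^ (c - b - 1) * (1 - z * t) ^ (-a)

/-- The quotient of Gamma functions in the Mellin-Barnes integrand of `G^{m,n}_{p,q}`, with
`p = a.length` upper and `q = b.length` lower parameters. A factor `1 / Γ` vanishes at the poles
of `Γ`, in agreement with Mathlib's conventions. -/
def gammaQuot (m n : ℕ) (a b : List ℂ) (s : ℂ) : ℂ :=
  (((b.take m).map fun x => Complex.Gamma (x - s)).prod *
      ((a.take n).map fun x => Complex.Gamma (1 - x + s)).prod) /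
    (((b.drop m).map fun x => Complex.Gamma (1 - x + s)).prod *
      ((a.drop n).map fun x => Complex.Gamma (x - s)).prod)

/-- The vertical line `Re s = c` has all the poles of `Γ(b_j - s)`, `j ≤ m`, on its right and all
the poles of `Γ(1 - a_j + s)`, `j ≤ n`, on its left. -/
def Separates (m n : ℕ) (a b : List ℂ) (c : ℝ) : Prop :=
  (∀ x ∈ b.take m, c < x.re) ∧ (∀ x ∈ a.take n, x.re - 1 < c)

/-- The point `c + i y`. -/
def vline (c y : ℝ) : ℂ := (c : ℂ) + (y : ℂ) * Complex.I

/-- The integrand of the Meijer G-function on the line `Re s = c`. -/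
def meijerIntegrand (m n : ℕ) (a b : List ℂ) (z : ℂ) (c y : ℝ) : ℂ :=
  gammaQuot m n a b (vline c y) * z ^ vline c y

/-- `(1 / 2πi) ∫ gammaQuot(s) z^s ds` along the line `Re s = c`, upwards. -/
def meijerLine (m n : ℕ) (a b : List ℂ) (z : ℂ) (c : ℝ) : ℂ :=
  1 / (2 * (Real.pi : ℂ)) * ∫ y : ℝ, meijerIntegrand m n a b z c y

open Classical in
/-- The Meijer G-function `G^{m,n}_{p,q}(z | a ; b)` for parameters whose two families of poles
can be separated by a vertical line: the Mellin-Barnes integral along such a line. That the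
integral converges and does not depend on the line is expressed by `MeijerGConverges`. -/
def meijerG (m n : ℕ) (a b : List ℂ) (z : ℂ) : ℂ :=
  if h : ∃ c, Separates m n a b c then meijerLine m n a b z h.choose else 0

/-- The defining integral of `meijerG` makes sense: there is a separating vertical line, and on
every such line the integral converges absolutely, with value `meijerG`. -/
def MeijerGConverges (m n : ℕ) (a b : List ℂ) (z : ℂ) : Prop :=
  (∃ c, Separates m n a b c) ∧
    ∀ c, Separates m n a b c →
      Integrable (meijerIntegrand m n a b z c) ∧ meijerLine m n a b z c = meijerG m n a b z

/-- The indices `(m, n)` and the upper and lower parameters of one block of a Meijer G-function. -/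
structure GBlock where
  m : ℕ
  n : ℕ
  a : List ℂ
  b : List ℂ

/-- Separation of the poles for the bivariate Meijer G-function on `Re s = c₁`, `Re t = c₂`: the
first block depends on `s + t`, the second on `s`, the third on `t`. -/
def Separates2 (o u v : GBlock) (c₁ c₂ : ℝ) : Prop :=
  Separates o.m o.n o.a o.b (c₁ + c₂) ∧ Separates u.m u.n u.a u.b c₁ ∧
    Separates v.m v.n v.a v.b c₂

/-- The integrand of the bivariate Meijer G-function on `Re s = c₁`, `Re t = c₂`. -/
def meijer2Integrand (o u v : GBlock) (z w : ℂ) (c₁ c₂ : ℝ) (y : ℝ × ℝ) : ℂ :=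
  gammaQuot o.m o.n o.a o.b (vline c₁ y.1 + vline c₂ y.2) *
    gammaQuot u.m u.n u.a u.b (vline c₁ y.1) * gammaQuot v.m v.n v.a v.b (vline c₂ y.2) *
    z ^ vline c₁ y.1 * w ^ vline c₂ y.2

/-- `(1 / 2πi)² ∬ (integrand) ds dt` along `Re s = c₁`, `Re t = c₂`. -/
def meijer2Line (o u v : GBlock) (z w : ℂ) (c₁ c₂ : ℝ) : ℂ :=
  1 / (2 * (Real.pi : ℂ)) ^ 2 * ∫ y : ℝ × ℝ, meijer2Integrand o u v z w c₁ c₂ y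

open Classical in
/-- The bivariate Meijer G-function
`G^{m,n : m₁,n₁ : m₂,n₂}_{p,q : p₁,q₁ : p₂,q₂}(o | u | v | z, w)`. -/
def meijerG2 (o u v : GBlock) (z w : ℂ) : ℂ :=
  if h : ∃ c : ℝ × ℝ, Separates2 o u v c.1 c.2 then
    meijer2Line o u v z w h.choose.1 h.choose.2 else 0

/-- The defining integral of `meijerG2` makes sense: there are separating lines, and on all such
lines the integral converges absolutely, with value `meijerG2`. -/
def MeijerG2Converges (o u v : GBlock) (z w : ℂ) : Prop :=
  (∃ c : ℝ × ℝ, Separates2 o u v c.1 c.2) ∧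
    ∀ c₁ c₂, Separates2 o u v c₁ c₂ →
      Integrable (meijer2Integrand o u v z w c₁ c₂) ∧
        meijer2Line o u v z w c₁ c₂ = meijerG2 o u v z w

/-! ### Parameters of the system -/

/-- Parameters of the satellite-relay-user system. -/
structure RelayParams where
  /-- half of the average multipath power of the S-R link -/
  bs : ℝ
  /-- average line-of-sight power of the S-R link -/
  Ωsr : ℝ
  /-- (integer) Nakagami parameter of the S-R link -/
  Γs : ℕ
  /-- average transmit SNR of the S-R link -/
  gSR : ℝ
  /-- fading parameter of the R-U link -/
  m : ℝ
  /-- shadowing parameter of the R-U link -/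
  ms : ℝ
  /-- shadowing power of the R-U link -/
  Ωs : ℝ
  /-- mean multipath power of the R-U link -/
  Ωm : ℝ
  /-- average transmit SNR of the R-U link -/
  gRU : ℝ
  /-- constant of the fixed relay gain -/
  C : ℝ
  /-- bandwidth -/
  B : ℝ
  /-- time duration -/
  T : ℝ
  /-- QoS exponent -/
  θ : ℝ
  bs_pos : 0 < bs
  Ωsr_nonneg : 0 ≤ Ωsr
  Γs_pos : 0 < Γs
  gSR_pos : 0 < gSR
  m_pos : 0 < m
  ms_pos : 0 < ms
  Ωs_pos : 0 < Ωs
  Ωm_pos : 0 < Ωm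
  gRU_pos : 0 < gRU
  C_pos : 0 < C
  B_pos : 0 < B
  T_pos : 0 < T
  θ_pos : 0 < θ

namespace RelayParams

variable (p : RelayParams)

/-- `α_SR`. -/
def αSR : ℝ := 1 / (2 * p.bs) * (2 * p.bs * p.Γs / (2 * p.bs * p.Γs + p.Ωsr)) ^ p.Γs

/-- `β_SR`. -/
def βSR : ℝ := 1 / (2 * p.bs)

/-- `δ_SR`. -/
def δSR : ℝ := p.Ωsr / (2 * p.bs * (2 * p.bs * p.Γs + p.Ωsr))

/-- `c_k = (-1)^k (1 - Γ_s)_k δ_SR^k / (k!)²`. -/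
def c (k : ℕ) : ℝ :=
  (-1) ^ k * (ascPochhammer ℝ k).eval (1 - (p.Γs : ℝ)) * p.δSR ^ k / ((k.factorial : ℝ)) ^ 2

/-- The normalized QoS exponent `β = B T θ / log 2`. -/
def β : ℝ := p.B * p.T * p.θ / Real.log 2

/-- `(β_SR - δ_SR) / γ̄_SR`. -/
def rSR : ℝ := (p.βSR - p.δSR) / p.gSR

/-- `m Ω_s / (m_s Ω_m γ̄_RU)`. -/
def A : ℝ := p.m * p.Ωs / (p.ms * p.Ωm * p.gRU)

/-- The shadowed-Rician density of `|h_SR|²` at `x > 0`. -/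
def pdfPowerSR (x : ℝ) : ℝ :=
  p.αSR * Real.exp (-p.βSR * x) * hyp1F1 p.Γs 1 (p.δSR * x)

/-- The Fisher-Snedecor density of `|h_RU|` at `x > 0`. -/
def pdfAmplitudeRU (x : ℝ) : ℝ :=
  2 * (p.m * p.Ωs) ^ p.m * (p.ms * p.Ωm) ^ p.ms * x ^ (2 * p.m - 1) /
    (beta p.m p.ms * (p.m * p.Ωs * x ^ 2 + p.ms * p.Ωm) ^ (p.m + p.ms))

/-- The density of `γ_SR` at `x > 0`. -/
def pdfSR (x : ℝ) : ℝ := 1 / p.gSR * p.pdfPowerSR (x / p.gSR)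

/-- The density of `γ_RU` at `x > 0`. -/
def pdfRU (x : ℝ) : ℝ :=
  (p.m * p.Ωs) ^ p.m * (p.ms * p.Ωm * p.gRU) ^ p.ms * x ^ (p.m - 1) /
    (beta p.m p.ms * (p.m * p.Ωs * x + p.ms * p.Ωm * p.gRU) ^ (p.m + p.ms))

end RelayParams

/-! ### The random channel and the effective capacity -/

/-- The measure on `(0, ∞)` with density `f`. -/
def densityLaw (f : ℝ → ℝ) : Measure ℝ :=
  (volume.restrict (Set.Ioi 0)).withDensity fun x => ENNReal.ofReal (f x)

/-- `hSR` and `hRU` are independent channel coefficients, shadowed-Rician and Fisher-Snedecor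
respectively. -/
structure IsRelayChannel {Ω : Type*} [MeasurableSpace Ω] (p : RelayParams) (P : Measure Ω)
    (hSR hRU : Ω → ℂ) : Prop where
  measurable_SR : Measurable hSR
  measurable_RU : Measurable hRU
  law_SR : P.map (fun ω => ‖hSR ω‖ ^ 2) = densityLaw p.pdfPowerSR
  law_RU : P.map (fun ω => ‖hRU ω‖) = densityLaw p.pdfAmplitudeRU
  indep : IndepFun hSR hRU P

section
variable {Ω : Type*}

/-- SNR of a link with average transmit SNR `g` and channel coefficient `h`. -/
def linkSNR (g : ℝ) (h : Ω → ℂ) (ω : Ω) : ℝ := g * ‖h ω‖ ^ 2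

/-- SNR of the fixed-gain amplify-and-forward relay. -/
def snrAF (p : RelayParams) (hSR hRU : Ω → ℂ) (ω : Ω) : ℝ :=
  linkSNR p.gSR hSR ω * linkSNR p.gRU hRU ω / (linkSNR p.gRU hRU ω + p.C)

/-- SNR of the decode-and-forward relay. -/
def snrDF (p : RelayParams) (hSR hRU : Ω → ℂ) (ω : Ω) : ℝ :=
  min (linkSNR p.gSR hSR ω) (linkSNR p.gRU hRU ω)

/-- Cumulative distribution function of `X`. -/
def distFun [MeasurableSpace Ω] (P : Measure Ω) (X : Ω → ℝ) (x : ℝ) : ℝ := P.real {ω | X ω ≤ x}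

/-- The effective capacity `-(1/θ) log E[e^{-θ R}]` with service rate `R = B T log₂(1 + γ)`. -/
def effectiveCapacity [MeasurableSpace Ω] (p : RelayParams) (P : Measure Ω) (γ : Ω → ℝ) : ℝ :=
  -(1 / p.θ) * Real.log
    (∫ ω, Real.exp (-(p.θ * (p.B * p.T * Real.logb 2 (1 + γ ω)))) ∂P)

/-- `𝓛(x) = ∫₀^∞ F_RU(C x / y) f_SR(y + x) dy`. -/
def termL [MeasurableSpace Ω] (p : RelayParams) (P : Measure Ω) (hRU : Ω → ℂ) (x : ℝ) : ℝ :=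
  ∫ y in Set.Ioi (0 : ℝ), distFun P (linkSNR p.gRU hRU) (p.C * x / y) * p.pdfSR (y + x)

end

/-! ### The closed forms -/

namespace RelayParams

variable (p : RelayParams)

/-- Closed form of `E[(1 + γ_SR)^{-β}]`. -/
def closedSR : ℂ :=
  (p.αSR / Real.Gamma p.β : ℝ) * ∑ k ∈ Finset.range p.Γs,
    (p.c k / p.gSR ^ (k + 1) : ℝ) *
      meijerG 2 1 [-(k : ℂ)] [(p.β : ℂ) - k - 1, 0] (p.rSR : ℂ)

/-- Closed form of `E[(1 + γ_RU)^{-β}]`. -/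
def closedRU : ℂ :=
  (1 / (Real.Gamma p.m * Real.Gamma p.ms * Real.Gamma p.β) : ℝ) *
    meijerG 2 2 [1, 1 - (p.ms : ℂ)] [(p.β : ℂ), (p.m : ℂ)] (p.A : ℂ)

/-- Closed form of `M₁`. -/
def closedM1 : ℂ :=
  ∑ k ∈ Finset.range p.Γs, (p.αSR * p.c k / (p.βSR - p.δSR) ^ (k + 1) : ℝ) *
    ((Real.Gamma (k + 1) / p.β : ℝ) -
      meijerG 3 1 [0, 1] [(p.β : ℂ), 0, (k : ℂ) + 1] (p.rSR : ℂ) /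
        (Real.Gamma (p.β + 1) : ℝ))

/-- `d_k`. -/
def d (k : ℕ) : ℝ :=
  p.αSR * p.c k / (Real.Gamma p.m * Real.Gamma p.ms * (p.βSR - p.δSR) ^ (k + 1))

/-- Outer block of the bivariate G-functions in `M₂`. -/
def blockM2o : GBlock := ⟨1, 1, [0], [(p.β : ℂ)]⟩

/-- First inner block in `M₂`. -/
def blockM2u (k i : ℕ) : GBlock := ⟨1, 0, [], [(k : ℂ) - i]⟩

/-- Second inner block in `M₂`. -/
def blockM2v (i : ℕ) : GBlock := ⟨2, 2, [1 - (p.ms : ℂ), 1], [(p.m : ℂ), 1 + (i : ℂ), 0]⟩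

/-- Closed form of `M₂`, with `G^{1,1:1,0:2,2}_{1,1:0,1:2,3}`. -/
def closedM2 : ℂ :=
  ∑ k ∈ Finset.range p.Γs, (p.d k / Real.Gamma (p.β + 1) : ℝ) *
    ∑ i ∈ Finset.range (k + 1), (k.choose i : ℂ) *
      meijerG2 p.blockM2o (blockM2u k i) (p.blockM2v i) (p.rSR : ℂ) ((p.rSR * p.A * p.C : ℝ) : ℂ)

/-- Outer block of the bivariate G-functions in `N₁`. -/
def blockN1o (k : ℕ) : GBlock := ⟨1, 1, [-(k : ℂ)], [-(k : ℂ) - 1 + p.β]⟩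

/-- First inner block in `N₁`. -/
def blockN1u : GBlock := ⟨1, 0, [], [0]⟩

/-- Second inner block in `N₁`. -/
def blockN1v : GBlock := ⟨1, 2, [1 - (p.ms : ℂ), 1], [(p.m : ℂ), 0]⟩

/-- Closed form of `N₁`, with `G^{1,1:1,0:1,2}_{1,1:0,1:2,2}`. -/
def closedN1 : ℂ :=
  ∑ k ∈ Finset.range p.Γs,
    (p.αSR * p.c k /
      (Real.Gamma p.m * Real.Gamma p.ms * Real.Gamma p.β * p.gSR ^ (k + 1)) : ℝ) *
      meijerG2 (p.blockN1o k) blockN1u p.blockN1v (p.rSR : ℂ) (p.A : ℂ)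

/-- `g_k`. -/
def g (k : ℕ) : ℝ :=
  p.αSR * p.c k * p.A ^ p.m / (beta p.m p.ms * (p.βSR - p.δSR) ^ (k + 1))

/-- Outer block of the bivariate G-functions in `N₂`. -/
def blockN2o : GBlock := ⟨1, 1, [1 - (p.m : ℂ)], [(p.β : ℂ) - p.m]⟩

/-- First inner block in `N₂`. -/
def blockN2u : GBlock := ⟨1, 1, [1 - (p.m : ℂ) - p.ms], [0]⟩

/-- Second inner block in `N₂`. -/
def blockN2v (k : ℕ) : GBlock := ⟨2, 0, [1], [0, (k : ℂ) + 1]⟩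

/-- Closed form of `N₂`, with `₂F₁` and `G^{1,1:1,1:2,0}_{1,1:1,1:1,2}`. -/
def closedN2 : ℂ :=
  ∑ k ∈ Finset.range p.Γs, (p.g k : ℂ) *
    ((Real.Gamma (k + 1) * beta p.m (p.ms + p.β) *
        hyp2F1 (p.m + p.ms) p.m (p.m + p.ms + p.β) (1 - p.A) : ℝ) -
      (1 / (Real.Gamma (p.m + p.ms) * Real.Gamma p.β) : ℝ) *
        meijerG2 p.blockN2o p.blockN2u (blockN2v k) (p.A : ℂ) (p.rSR : ℂ))

/-- All the Meijer G-functions in the closed forms are given by convergent integrals. -/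
def AllConverge : Prop :=
  (∀ k < p.Γs, MeijerGConverges 2 1 [-(k : ℂ)] [(p.β : ℂ) - k - 1, 0] (p.rSR : ℂ)) ∧
  MeijerGConverges 2 2 [1, 1 - (p.ms : ℂ)] [(p.β : ℂ), (p.m : ℂ)] (p.A : ℂ) ∧
  (∀ k < p.Γs, MeijerGConverges 3 1 [0, 1] [(p.β : ℂ), 0, (k : ℂ) + 1] (p.rSR : ℂ)) ∧
  (∀ k < p.Γs, ∀ i ≤ k, MeijerG2Converges p.blockM2o (blockM2u k i) (p.blockM2v i)
    (p.rSR : ℂ) ((p.rSR * p.A * p.C : ℝ) : ℂ)) ∧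
  (∀ k < p.Γs, MeijerG2Converges (p.blockN1o k) blockN1u p.blockN1v (p.rSR : ℂ) (p.A : ℂ)) ∧
  (∀ k < p.Γs, MeijerG2Converges p.blockN2o p.blockN2u (blockN2v k) (p.A : ℂ) (p.rSR : ℂ))

end RelayParams

end

noncomputable section

/-! ### Mellin–Barnes representations on vertical lines -/

/-! Every closed form comes from real integrals over `(0, ∞)` of a few elementary kernels, and the
Meijer functions are the Mellin–Barnes forms of those integrals. The working notion is `MellinRep`:
a real function `f` is the inverse Mellin integral of `Φ` on the line `Re s = c`, with `Φ`
absolutely integrable there. Mellin inversion supplies it for `x ^ a * exp (-x)` and `x ^ a * (1 +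
x) ^ (-b)`, whose moments are Gamma and Beta integrals (`mellinRep_gamKer`, `mellinRep_betaKer`). By
Fubini, averaging the dilates `f (x * X)` against a weight `k` multiplies `Φ` by the moments `∫ k X
^ s` (`MellinRep.average`); this yields the incomplete Gamma and Beta functions and then the
univariate Meijer integrands. Averaging a product of two represented functions gives a double
integral with the moments taken at `s + t` (`MellinRep.bivariate`), which is the shape of the
bivariate Meijer function.

The argument runs on an arbitrary separating line, and the resulting real integral does not mention
the line. Absolute convergence, independence of the line and evaluation therefore come together,
without shifting contours (`meijerG_of_mellinRep`, `meijerG2_of_lines`).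

On the probabilistic side, since `Γs` is a positive integer, Kummer's transformation makes the S-R
density a finite sum of Gamma kernels (`hyp1F1_nat_succ_one`, `RelayParams.pdfSR_eq`), while the R-U
density is a rescaled Beta kernel (`RelayParams.pdfRU_eq`); their distribution functions involve the
incomplete functions. The expectations reduce to one-dimensional integrals: for AF by integrating
the distribution function (`integral_one_add_rpow_eq`) and conditioning on the first hop
(`distFun_mul_div_add`), for DF by splitting according to which hop is weaker
(`integral_one_add_min_rpow`). Term by term these are the integrals evaluated before, and only
constants remain to be compared. -/

lemma vline_re (c y : ℝ) : (vline c y).re = c := by simp [vline]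

lemma vline_im (c y : ℝ) : (vline c y).im = y := by simp [vline]

lemma continuous_vline (c : ℝ) : Continuous (vline c) := by unfold vline; fun_prop

lemma norm_cpow_vline {x : ℝ} (hx : 0 < x) (c y : ℝ) : ‖(x : ℂ) ^ vline c y‖ = x ^ c := by
  rw [Complex.norm_cpow_eq_rpow_re_of_pos hx, vline_re]

lemma continuous_cpow_vline {x : ℝ} (hx : 0 < x) (c : ℝ) :
    Continuous fun y => (x : ℂ) ^ vline c y :=
  (continuous_vline c).const_cpow (Or.inl (by exact_mod_cast hx.ne'))

lemma ofReal_mul_cpow {x y : ℝ} (hx : 0 < x) (hy : 0 < y) (s : ℂ) :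
    ((x * y : ℝ) : ℂ) ^ s = (x : ℂ) ^ s * (y : ℂ) ^ s := by
  rw [Complex.ofReal_mul, Complex.mul_cpow_ofReal_nonneg hx.le hy.le]

/-- `Φ` is absolutely integrable on the line `Re s = c`, and its Mellin–Barnes integral along that
line is `f`. -/
structure MellinRep (f : ℝ → ℝ) (Φ : ℂ → ℂ) (c : ℝ) : Prop where
  integrable : Integrable fun y => Φ (vline c y)
  eq : ∀ x, 0 < x →
    (f x : ℂ) = 1 / (2 * (Real.pi : ℂ)) * ∫ y, Φ (vline c y) * (x : ℂ) ^ vline c y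

/-- Integrands are compared only on the line, because the Gamma identities used later cancel factors
whose nonvanishing depends on `Re s`. -/
lemma MellinRep.congr {f g : ℝ → ℝ} {Φ Ψ : ℂ → ℂ} {c : ℝ} (h : MellinRep f Φ c)
    (hfg : ∀ x, 0 < x → f x = g x) (hΦ : ∀ y, Φ (vline c y) = Ψ (vline c y)) :
    MellinRep g Ψ c := by
  obtain ⟨h1, h2⟩ := h
  simp only [hΦ] at h1 h2
  exact ⟨h1, fun x hx => by rw [← hfg x hx, h2 x hx]⟩

lemma MellinRep.const_mul {f : ℝ → ℝ} {Φ : ℂ → ℂ} {c : ℝ} (h : MellinRep f Φ c) (a : ℝ) :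
    MellinRep (fun x => a * f x) (fun s => a * Φ s) c := by
  refine ⟨h.integrable.const_mul _, fun x hx => ?_⟩
  simp only [mul_assoc, integral_const_mul]
  rw [Complex.ofReal_mul, h.eq x hx]
  ring

lemma MellinRep.integrable_mul_cpow {f : ℝ → ℝ} {Φ : ℂ → ℂ} {c : ℝ} (h : MellinRep f Φ c)
    {x : ℝ} (hx : 0 < x) : Integrable fun y => Φ (vline c y) * (x : ℂ) ^ vline c y :=
  h.integrable.mul_bdd (c := x ^ c) (continuous_cpow_vline hx c).aestronglyMeasurable
    (.of_forall fun y => (norm_cpow_vline hx c y).le)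

/-! ### Averages over dilations, in one and two Mellin variables -/

section Averages

variable {α : Type*} [MeasurableSpace α] {μ : Measure α} {k X : α → ℝ} {c : ℝ}

/-- The Fubini hypothesis for all averages. The power at `c + iθ` is `X ^ c` times a unimodular
factor, so the integrand is a product of integrable functions times something of norm one. The free
`θ` covers both one line variable and the sum of two. -/
lemma integrable_prod_cpow_vline {T : Type*} [MeasurableSpace T] {ν : Measure T} [SFinite ν]
    (hX : Measurable X) (hX0 : ∀ᵐ a ∂μ, 0 < X a)
    (hk : Integrable (fun a => k a * X a ^ c) μ) {G : T → ℂ} (hG : Integrable G ν)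
    {θ : T → ℝ} (hθ : Measurable θ) :
    Integrable (fun p : α × T => (k p.1 : ℂ) * (X p.1 : ℂ) ^ vline c (θ p.2) * G p.2)
      (μ.prod ν) := by
  have h0 : ∀ᵐ p ∂μ.prod ν, 0 < X p.1 := Measure.quasiMeasurePreserving_fst.ae hX0
  have hm : Measurable fun p : α × T => (X p.1 : ℂ) ^ ((θ p.2 : ℂ) * Complex.I) := by fun_prop
  have h1 := (hk.ofReal (𝕜 := ℂ)).mul_prod hG
  refine (h1.bdd_mul (c := 1) hm.aestronglyMeasurable ?_).congr ?_
  · filter_upwards [h0] with p hp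
    rw [Complex.norm_cpow_eq_rpow_re_of_pos hp]
    simp
  · filter_upwards [h0] with p hp
    have : ((X p.1 : ℝ) : ℂ) ≠ 0 := by exact_mod_cast hp.ne'
    simp only [vline, Complex.cpow_add _ _ this]
    have e : ((k p.1 * X p.1 ^ c : ℝ) : ℂ) = k p.1 * (X p.1 : ℂ) ^ (c : ℂ) := by
      rw [Complex.ofReal_mul, Complex.ofReal_cpow hp.le]
    simp only [Complex.coe_algebraMap, e]
    ring

variable {f g : ℝ → ℝ} {Φ Φ₂ Ψ : ℂ → ℂ} {c₂ : ℝ}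

lemma MellinRep.average_eq (h : MellinRep f Φ c) (hX0 : ∀ᵐ a ∂μ, 0 < X a) {x : ℝ} (hx : 0 < x) :
    (fun a => ((k a * f (x * X a) : ℝ) : ℂ)) =ᵐ[μ] fun a => 1 / (2 * (Real.pi : ℂ)) *
      ∫ y, (k a : ℂ) * (X a : ℂ) ^ vline c y * (Φ (vline c y) * (x : ℂ) ^ vline c y) := by
  filter_upwards [hX0] with a ha
  rw [Complex.ofReal_mul, h.eq _ (mul_pos hx ha)]
  simp only [ofReal_mul_cpow hx ha, mul_assoc (k a : ℂ), integral_const_mul]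
  rw [mul_left_comm]
  congr 2
  refine congrArg _ (funext fun y => ?_)
  ring

lemma MellinRep.integrable_average [SFinite μ] (h : MellinRep f Φ c) (hX : Measurable X)
    (hX0 : ∀ᵐ a ∂μ, 0 < X a) (hk : Integrable (fun a => k a * X a ^ c) μ) {x : ℝ} (hx : 0 < x) :
    Integrable (fun a => k a * f (x * X a)) μ := by
  have h1 := (integrable_prod_cpow_vline hX hX0 hk (h.integrable_mul_cpow hx)
    measurable_id).integral_prod_left.const_mul (1 / (2 * (Real.pi : ℂ)))
  have h2 : Integrable (fun a => ((k a * f (x * X a) : ℝ) : ℂ)) μ :=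
    h1.congr (h.average_eq hX0 hx).symm
  simpa using h2.re

/-- Averaging dilations of `f` multiplies its Mellin–Barnes integrand by the moments of the
weight. -/
theorem MellinRep.average [SFinite μ] (h : MellinRep f Φ c) (hX : Measurable X)
    (hX0 : ∀ᵐ a ∂μ, 0 < X a) (hk : Integrable (fun a => k a * X a ^ c) μ)
    (hΨ : ∀ y, ∫ a, (k a : ℂ) * (X a : ℂ) ^ vline c y ∂μ = Ψ (vline c y)) :
    MellinRep (fun x => ∫ a, k a * f (x * X a) ∂μ) (fun s => Ψ s * Φ s) c := by
  constructor
  · have := (integrable_prod_cpow_vline hX hX0 hk h.integrable measurable_id).integral_prod_right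
    simpa only [integral_mul_const, id, hΨ] using this
  · intro x hx
    have h1 := integrable_prod_cpow_vline hX hX0 hk (h.integrable_mul_cpow hx) measurable_id
    rw [← integral_complex_ofReal, integral_congr_ae (h.average_eq hX0 hx), integral_const_mul,
      integral_integral_swap h1]
    simp only [integral_mul_const, hΨ]
    simp only [mul_assoc]

theorem MellinRep.integrable_bivariate (h : MellinRep f Φ c) (h₂ : MellinRep g Φ₂ c₂)
    (hX : Measurable X) (hX0 : ∀ᵐ a ∂μ, 0 < X a)
    (hk : Integrable (fun a => k a * X a ^ (c + c₂)) μ) {z w : ℝ} (hz : 0 < z) (hw : 0 < w) :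
    Integrable (fun p : α × ℝ × ℝ => (k p.1 : ℂ) * (X p.1 : ℂ) ^ vline (c + c₂) (p.2.1 + p.2.2) *
      (Φ (vline c p.2.1) * (z : ℂ) ^ vline c p.2.1 *
        (Φ₂ (vline c₂ p.2.2) * (w : ℂ) ^ vline c₂ p.2.2))) (μ.prod (volume.prod volume)) := by
  have hG : Integrable (fun q : ℝ × ℝ => Φ (vline c q.1) * (z : ℂ) ^ vline c q.1 *
      (Φ₂ (vline c₂ q.2) * (w : ℂ) ^ vline c₂ q.2)) (volume.prod volume) :=
    (h.integrable_mul_cpow hz).mul_prod (h₂.integrable_mul_cpow hw)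
  exact integrable_prod_cpow_vline hX hX0 hk hG (θ := fun q => q.1 + q.2)
    (measurable_fst.add measurable_snd)

lemma vline_add (c₁ c₂ y₁ y₂ : ℝ) : vline (c₁ + c₂) (y₁ + y₂) = vline c₁ y₁ + vline c₂ y₂ := by
  simp only [vline]; push_cast; ring

lemma MellinRep.bivariate_eq (h : MellinRep f Φ c) (h₂ : MellinRep g Φ₂ c₂)
    (hX0 : ∀ᵐ a ∂μ, 0 < X a) {z w : ℝ} (hz : 0 < z) (hw : 0 < w) :
    (fun a => ((k a * (f (z * X a) * g (w * X a)) : ℝ) : ℂ)) =ᵐ[μ]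
      fun a => 1 / (2 * (Real.pi : ℂ)) ^ 2 * ∫ p : ℝ × ℝ,
        (k a : ℂ) * (X a : ℂ) ^ vline (c + c₂) (p.1 + p.2) *
          (Φ (vline c p.1) * (z : ℂ) ^ vline c p.1 *
            (Φ₂ (vline c₂ p.2) * (w : ℂ) ^ vline c₂ p.2)) := by
  filter_upwards [hX0] with a ha
  have ha' : ((X a : ℝ) : ℂ) ≠ 0 := by exact_mod_cast ha.ne'
  rw [Complex.ofReal_mul, Complex.ofReal_mul, h.eq _ (mul_pos hz ha), h₂.eq _ (mul_pos hw ha)]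
  simp only [ofReal_mul_cpow hz ha, ofReal_mul_cpow hw ha, mul_assoc (k a : ℂ),
    integral_const_mul, vline_add, Complex.cpow_add _ _ ha']
  have : ∀ u v : ℂ, (1 / (2 * (Real.pi : ℂ)) * u) * (1 / (2 * (Real.pi : ℂ)) * v) =
      1 / (2 * (Real.pi : ℂ)) ^ 2 * (u * v) := fun u v => by ring
  rw [this, mul_left_comm, ← integral_prod_mul]
  congr 2
  refine congrArg _ (funext fun y => ?_)
  ring

lemma MellinRep.integrable_bivariate_average [SFinite μ] (h : MellinRep f Φ c) (h₂ : MellinRep g Φ₂ c₂)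
    (hX : Measurable X) (hX0 : ∀ᵐ a ∂μ, 0 < X a)
    (hk : Integrable (fun a => k a * X a ^ (c + c₂)) μ) {z w : ℝ} (hz : 0 < z) (hw : 0 < w) :
    Integrable (fun a => k a * (f (z * X a) * g (w * X a))) μ := by
  have h1 := (h.integrable_bivariate h₂ hX hX0 hk hz hw).integral_prod_left.const_mul
    (1 / (2 * (Real.pi : ℂ)) ^ 2)
  have h2 : Integrable (fun a => ((k a * (f (z * X a) * g (w * X a)) : ℝ) : ℂ)) μ :=
    h1.congr (h.bivariate_eq h₂ hX0 hz hw).symm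
  simpa using h2.re

/-- In the product of the two Mellin integrals `X` occurs only through `X ^ s * X ^ t = X ^ (s +
t)`. Integrating over `X` first leaves the moment at `s + t`, which becomes the outer block of a
bivariate Meijer function. -/
theorem MellinRep.bivariate [SFinite μ] (h : MellinRep f Φ c) (h₂ : MellinRep g Φ₂ c₂)
    (hX : Measurable X) (hX0 : ∀ᵐ a ∂μ, 0 < X a)
    (hk : Integrable (fun a => k a * X a ^ (c + c₂)) μ)
    (hΨ : ∀ y, ∫ a, (k a : ℂ) * (X a : ℂ) ^ vline (c + c₂) y ∂μ = Ψ (vline (c + c₂) y))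
    {z w : ℝ} (hz : 0 < z) (hw : 0 < w) :
    Integrable (fun y : ℝ × ℝ => Ψ (vline c y.1 + vline c₂ y.2) * Φ (vline c y.1) *
        Φ₂ (vline c₂ y.2) * (z : ℂ) ^ vline c y.1 * (w : ℂ) ^ vline c₂ y.2) ∧
      1 / (2 * (Real.pi : ℂ)) ^ 2 * ∫ y : ℝ × ℝ, Ψ (vline c y.1 + vline c₂ y.2) *
        Φ (vline c y.1) * Φ₂ (vline c₂ y.2) * (z : ℂ) ^ vline c y.1 * (w : ℂ) ^ vline c₂ y.2 =
      ((∫ a, k a * (f (z * X a) * g (w * X a)) ∂μ : ℝ) : ℂ) := by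
  have h1 := h.integrable_bivariate h₂ hX hX0 hk hz hw
  have e : ∀ y : ℝ × ℝ, ∫ a, (k a : ℂ) * (X a : ℂ) ^ vline (c + c₂) (y.1 + y.2) *
      (Φ (vline c y.1) * (z : ℂ) ^ vline c y.1 *
        (Φ₂ (vline c₂ y.2) * (w : ℂ) ^ vline c₂ y.2)) ∂μ =
      Ψ (vline c y.1 + vline c₂ y.2) * Φ (vline c y.1) *
        Φ₂ (vline c₂ y.2) * (z : ℂ) ^ vline c y.1 * (w : ℂ) ^ vline c₂ y.2 := fun y => by
    rw [integral_mul_const, hΨ, vline_add]; ring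
  constructor
  · have := h1.integral_prod_right
    simp only [e] at this
    exact this
  · rw [← integral_complex_ofReal, integral_congr_ae (h.bivariate_eq h₂ hX0 hz hw),
      integral_const_mul, integral_integral_swap h1]
    simp only [e]

end Averages

/-! ### Meijer G-functions from representations -/

/-- `F` is fixed before the line, so a representation of it on each separating line forces equal
values on all of them. `Q` carries out a fact free of the line whose proof needs one, namely
integrability of the real integrand. -/
theorem meijerG_of_mellinRep {m n : ℕ} {a b : List ℂ} {F : ℝ → ℝ} {Q : Prop}
    (hs : ∃ c, Separates m n a b c)
    (h : ∀ c, Separates m n a b c → MellinRep F (gammaQuot m n a b) c ∧ Q) {z : ℝ} (hz : 0 < z) :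
    MeijerGConverges m n a b z ∧ meijerG m n a b z = F z ∧ Q := by
  have key : ∀ c, Separates m n a b c → meijerLine m n a b z c = F z := fun c hc =>
    ((h c hc).1.eq z hz).symm
  have hG : meijerG m n a b z = F z := by
    rw [meijerG, dif_pos hs]
    exact key _ hs.choose_spec
  exact ⟨⟨hs, fun c hc => ⟨(h c hc).1.integrable_mul_cpow hz, by rw [hG, key c hc]⟩⟩, hG,
    (h _ hs.choose_spec).2⟩

theorem meijerG2_of_lines {o u v : GBlock} {z w : ℂ} {F : ℂ} {Q : Prop}
    (hs : ∃ c : ℝ × ℝ, Separates2 o u v c.1 c.2)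
    (h : ∀ c₁ c₂, Separates2 o u v c₁ c₂ →
      Integrable (meijer2Integrand o u v z w c₁ c₂) ∧ meijer2Line o u v z w c₁ c₂ = F ∧ Q) :
    MeijerG2Converges o u v z w ∧ meijerG2 o u v z w = F ∧ Q := by
  have hG : meijerG2 o u v z w = F := by
    rw [meijerG2, dif_pos hs]
    exact (h _ _ hs.choose_spec).2.1
  exact ⟨⟨hs, fun c₁ c₂ hc => ⟨(h c₁ c₂ hc).1, by rw [hG, (h c₁ c₂ hc).2.1]⟩⟩, hG,
    (h _ _ hs.choose_spec).2.2⟩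

/-! ### Gamma functions on vertical lines -/

lemma ofReal_cpow_eq_cexp {x : ℝ} (hx : 0 < x) (s : ℂ) :
    (x : ℂ) ^ s = Complex.exp (Real.log x * s) := by
  rw [Complex.cpow_def_of_ne_zero (by exact_mod_cast hx.ne'), Complex.ofReal_log hx.le]

lemma norm_Gamma_le {s : ℂ} (hs : 0 < s.re) : ‖Complex.Gamma s‖ ≤ Real.Gamma s.re := by
  rw [Complex.Gamma_eq_integral hs, Real.Gamma_eq_integral hs, Complex.GammaIntegral]
  refine (norm_integral_le_integral_norm _).trans (le_of_eq ?_)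
  refine setIntegral_congr_fun measurableSet_Ioi fun x (hx : 0 < x) => ?_
  simp only [norm_mul, Complex.norm_cpow_eq_rpow_re_of_pos hx, Complex.norm_real, Real.norm_eq_abs,
    abs_of_pos (Real.exp_pos _), Complex.sub_re, Complex.one_re]

lemma ne_neg_nat_of_re_pos {s : ℂ} (hs : 0 < s.re) (m : ℕ) : s ≠ -m := by
  rintro rfl
  simp at hs
  linarith [m.cast_nonneg (α := ℝ)]

lemma continuous_Gamma_vline {c : ℝ} (hc : 0 < c) :
    Continuous fun y => Complex.Gamma (vline c y) := by
  refine continuous_iff_continuousAt.2 fun y => ?_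
  exact (Complex.differentiableAt_Gamma _ (ne_neg_nat_of_re_pos
    (by rwa [vline_re]))).continuousAt.comp (continuous_vline c).continuousAt

/-- The recurrence used twice gives `Γ(s) = Γ(s + 2) / (s (s + 1))`. The numerator is bounded on the
line and the denominator grows like `1 + y ^ 2`, so no Stirling estimate is needed. -/
lemma integrable_Gamma_vline {c : ℝ} (hc : 0 < c) :
    Integrable fun y => Complex.Gamma (vline c y) := by
  refine (integrable_inv_one_add_sq.const_mul (Real.Gamma (c + 1 + 1) / min c 1)).mono'
    (continuous_Gamma_vline hc).aestronglyMeasurable (.of_forall fun y => ?_)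
  set s := vline c y with hs
  have hre : s.re = c := vline_re c y
  have him : s.im = y := vline_im c y
  have h0 : s ≠ 0 := fun h => by simp [h] at hre; linarith
  have h1 : s + 1 ≠ 0 := fun h => by
    have := congrArg Complex.re h; simp [hre] at this; linarith
  have e : Complex.Gamma (s + 1 + 1) = (s + 1) * (s * Complex.Gamma s) := by
    rw [Complex.Gamma_add_one _ h1, Complex.Gamma_add_one _ h0]
  have hle : ‖Complex.Gamma (s + 1 + 1)‖ ≤ Real.Gamma (c + 1 + 1) := by
    have := norm_Gamma_le (s := s + 1 + 1) (by simp [hre]; linarith)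
    simpa [hre] using this
  have hm : 0 < min c 1 := lt_min hc one_pos
  -- `‖s‖ ^ 2 = c ^ 2 + y ^ 2`; the minimum with 1 bounds both coefficients from below at once.
  have ns : min c 1 ^ 2 * (1 + y ^ 2) ≤ ‖s‖ ^ 2 := by
    rw [← Complex.normSq_eq_norm_sq, Complex.normSq_apply, hre, him]
    nlinarith [min_le_left c 1, min_le_right c 1, sq_nonneg y, mul_nonneg hm.le hm.le,
      mul_le_mul (min_le_left c 1) (min_le_left c 1) hm.le hc.le,
      mul_le_mul (min_le_right c 1) (min_le_right c 1) hm.le one_pos.le]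
  have ns1 : 1 + y ^ 2 ≤ ‖s + 1‖ ^ 2 := by
    rw [← Complex.normSq_eq_norm_sq, Complex.normSq_apply]
    simp [hre, him]
    nlinarith
  have hprod : min c 1 * (1 + y ^ 2) ≤ ‖s + 1‖ * ‖s‖ := by
    refine abs_le_of_sq_le_sq' ?_ (by positivity) |>.2
    calc (min c 1 * (1 + y ^ 2)) ^ 2 = (1 + y ^ 2) * (min c 1 ^ 2 * (1 + y ^ 2)) := by ring
      _ ≤ ‖s + 1‖ ^ 2 * ‖s‖ ^ 2 := by gcongr
      _ = _ := by ring
  have hy : (0 : ℝ) < 1 + y ^ 2 := by positivity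
  rw [div_mul_eq_mul_div, ← div_eq_mul_inv, div_div, le_div_iff₀ (by positivity)]
  calc ‖Complex.Gamma s‖ * ((1 + y ^ 2) * min c 1)
      ≤ ‖Complex.Gamma s‖ * (‖s + 1‖ * ‖s‖) := by
        refine mul_le_mul_of_nonneg_left ?_ (norm_nonneg _); linarith
    _ = ‖Complex.Gamma (s + 1 + 1)‖ := by rw [e]; simp only [norm_mul]; ring
    _ ≤ _ := hle

lemma ofReal_sub_vline (a c y : ℝ) : (a : ℂ) - vline c y = vline (a - c) (-y) := by
  simp only [vline]; push_cast; ring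

lemma ofReal_add_vline (a c y : ℝ) : (a : ℂ) + vline c y = vline (a + c) y := by
  simp only [vline]; push_cast; ring

lemma vline_ne_zero {c : ℝ} (hc : c ≠ 0) (y : ℝ) : vline c y ≠ 0 := fun h => by
  have := congrArg Complex.re h
  rw [vline_re] at this
  exact hc (by simpa using this)

lemma integrable_Gamma_sub_vline {a c : ℝ} (hc : c < a) :
    Integrable fun y => Complex.Gamma (a - vline c y) := by
  simp only [ofReal_sub_vline]
  exact (integrable_Gamma_vline (sub_pos.2 hc)).comp_neg

lemma integrable_Gamma_mul_Gamma_vline {a b c : ℝ} (hc : c < a) (hb : 0 < b + c) :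
    Integrable fun y => Complex.Gamma (a - vline c y) * Complex.Gamma (b + vline c y) := by
  refine (integrable_Gamma_sub_vline hc).mul_bdd (c := Real.Gamma (b + c)) ?_
    (.of_forall fun y => ?_)
  · simp only [ofReal_add_vline]
    exact (continuous_Gamma_vline hb).aestronglyMeasurable
  · have := norm_Gamma_le (s := b + vline c y) (by simpa [vline_re] using hb)
    simpa [vline_re] using this

/-! ### Mellin inversion of the elementary kernels -/

/-- Mellin inversion with the sign of the variable reversed: a Mellin transform at `-s` corresponds
to an expansion in `x ^ s`. Hence the line `-c` and the reflections `y ↦ -y` below. -/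
theorem mellinRep_of_moments {f : ℝ → ℝ} {Φ : ℂ → ℂ} {c : ℝ}
    (hf : ∀ x, 0 < x → ContinuousAt f x)
    (hc : IntegrableOn (fun t : ℝ => (f t : ℂ) * (t : ℂ) ^ (-(c : ℂ) - 1)) (Set.Ioi 0))
    (hΦ : Integrable fun y => Φ (vline c y))
    (h : ∀ y, ∫ t in Set.Ioi (0 : ℝ), (f t : ℂ) * (t : ℂ) ^ (-vline c y - 1) = Φ (vline c y)) :
    MellinRep f Φ c := by
  refine ⟨hΦ, fun x hx => ?_⟩
  have hv : ∀ y : ℝ, ((-c : ℝ) : ℂ) + y * Complex.I = -vline c (-y) := fun y => by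
    simp only [vline]; push_cast; ring
  have hm : ∀ y : ℝ, mellin (fun t => (f t : ℂ)) (((-c : ℝ) : ℂ) + y * Complex.I) =
      Φ (vline c (-y)) := fun y => by
    rw [hv, ← h, mellin]
    simp only [smul_eq_mul, mul_comm]
  have := mellinInv_mellin_eq (-c) (fun t => (f t : ℂ)) hx
    (by
      rw [MellinConvergent]
      refine hc.congr_fun (fun t _ => ?_) measurableSet_Ioi
      simp only [smul_eq_mul, mul_comm]; push_cast; rfl)
    (by
      rw [Complex.VerticalIntegrable]
      simp only [hm]
      exact hΦ.comp_neg)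
    (Complex.continuous_ofReal.continuousAt.comp (hf x hx))
  rw [← this, mellinInv]
  simp only [hm]
  simp only [hv, neg_neg, smul_eq_mul]
  rw [integral_neg_eq_self (fun y => (x : ℂ) ^ vline c y * Φ (vline c y)), Complex.real_smul]
  simp only [mul_comm]
  push_cast
  rfl

/-- The kernel `x ^ a * exp (-x)`. -/
def gamKer (a x : ℝ) : ℝ := x ^ a * Real.exp (-x)

/-- The kernel `x ^ a * (1 + x) ^ (-b)`. -/
def betaKer (a b x : ℝ) : ℝ := x ^ a * (1 + x) ^ (-b)

lemma gamKer_mul_cpow {a t : ℝ} (ht : 0 < t) (s : ℂ) :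
    (gamKer a t : ℂ) * (t : ℂ) ^ s = ((-t).exp : ℂ) * (t : ℂ) ^ (a + 1 + s - 1) := by
  have : ((t : ℝ) : ℂ) ≠ 0 := by exact_mod_cast ht.ne'
  rw [gamKer, Complex.ofReal_mul, Complex.ofReal_cpow ht.le,
    show (a : ℂ) + 1 + s - 1 = a + s by ring, Complex.cpow_add _ _ this]
  ring

lemma integrableOn_gamKer_mul_cpow {a : ℝ} {s : ℂ} (h : 0 < a + 1 + s.re) :
    IntegrableOn (fun t : ℝ => (gamKer a t : ℂ) * (t : ℂ) ^ s) (Set.Ioi 0) := by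
  have := Complex.GammaIntegral_convergent (s := a + 1 + s) (by simpa using h)
  exact this.congr_fun (fun t ht => (gamKer_mul_cpow ht s).symm) measurableSet_Ioi

lemma integral_gamKer_mul_cpow {a : ℝ} {s : ℂ} (h : 0 < a + 1 + s.re) :
    ∫ t in Set.Ioi (0 : ℝ), (gamKer a t : ℂ) * (t : ℂ) ^ s = Complex.Gamma (a + 1 + s) := by
  rw [Complex.Gamma_eq_integral (by simpa using h), Complex.GammaIntegral]
  exact setIntegral_congr_fun measurableSet_Ioi fun t ht => gamKer_mul_cpow ht s

/-- The substitution `x = t / (1 - t)` carries Beta-type integrals between `(0, 1)` and the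
half-line; it serves both for the moments of `betaKer` and for Euler's integral. -/
lemma image_div_one_sub : (fun t : ℝ => t / (1 - t)) '' Set.Ioo 0 1 = Set.Ioi 0 := by
  ext x
  constructor
  · rintro ⟨t, ⟨h0, h1⟩, rfl⟩
    exact div_pos h0 (sub_pos.2 h1)
  · intro (hx : 0 < x)
    refine ⟨x / (1 + x), ⟨by positivity, (div_lt_one (by positivity)).2 (by linarith)⟩, ?_⟩
    field_simp
    ring

lemma hasDerivWithinAt_div_one_sub : ∀ t ∈ Set.Ioo (0 : ℝ) 1,
    HasDerivWithinAt (fun t : ℝ => t / (1 - t)) (((1 - t) ^ 2)⁻¹) (Set.Ioo 0 1) t := by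
  intro t ht
  have h : 1 - t ≠ 0 := (sub_pos.2 ht.2).ne'
  have := (hasDerivAt_id t).div ((hasDerivAt_id t).const_sub 1) h
  refine (this.congr_deriv ?_).hasDerivWithinAt
  simp only [id]
  field_simp
  ring

lemma injOn_div_one_sub : Set.InjOn (fun t : ℝ => t / (1 - t)) (Set.Ioo 0 1) := by
  intro t ht u hu h
  have h1 : 1 - t ≠ 0 := (sub_pos.2 ht.2).ne'
  have h2 : 1 - u ≠ 0 := (sub_pos.2 hu.2).ne'
  simp only at h
  rw [div_eq_div_iff h1 h2] at h
  linarith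

lemma integral_Ioi_eq_integral_Ioo {E : Type*} [NormedAddCommGroup E] [NormedSpace ℝ E]
    (F : ℝ → E) : ∫ x in Set.Ioi (0 : ℝ), F x =
      ∫ t in Set.Ioo (0 : ℝ) 1, ((1 - t) ^ 2)⁻¹ • F (t / (1 - t)) := by
  rw [← image_div_one_sub, integral_image_eq_integral_abs_deriv_smul measurableSet_Ioo
    hasDerivWithinAt_div_one_sub injOn_div_one_sub]
  refine setIntegral_congr_fun measurableSet_Ioo fun t ht => ?_
  simp only [abs_of_nonneg (inv_nonneg.2 (sq_nonneg (1 - t)))]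

lemma integrableOn_Ioi_iff_Ioo {E : Type*} [NormedAddCommGroup E] [NormedSpace ℝ E]
    (F : ℝ → E) : IntegrableOn F (Set.Ioi 0) ↔
      IntegrableOn (fun t : ℝ => ((1 - t) ^ 2)⁻¹ • F (t / (1 - t))) (Set.Ioo 0 1) := by
  rw [← image_div_one_sub, integrableOn_image_iff_integrableOn_abs_deriv_smul measurableSet_Ioo
    hasDerivWithinAt_div_one_sub injOn_div_one_sub]
  refine integrableOn_congr_fun (fun t ht => ?_) measurableSet_Ioo
  simp only [abs_of_nonneg (inv_nonneg.2 (sq_nonneg (1 - t)))]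

lemma betaKer_subst {a b t : ℝ} (ht : t ∈ Set.Ioo (0 : ℝ) 1) (s : ℂ) :
    ((1 - t) ^ 2)⁻¹ • ((betaKer a b (t / (1 - t)) : ℂ) * ((t / (1 - t) : ℝ) : ℂ) ^ s) =
      (t : ℂ) ^ (a + 1 + s - 1) * (1 - (t : ℂ)) ^ (b - (a + 1 + s) - 1) := by
  have h0 : 0 < t := ht.1
  have h1 : 0 < 1 - t := sub_pos.2 ht.2
  have hx : 0 < t / (1 - t) := div_pos h0 h1
  have e1 : 1 + t / (1 - t) = (1 - t)⁻¹ := by field_simp; ring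
  -- With the Jacobian and all powers written as exponentials of `log t` and `log (1 - t)`, the
  -- claim is a linear identity between exponents.
  have e2 : ((1 - t) ^ 2)⁻¹ = Real.exp (Real.log (1 - t) * (-2)) := by
    rw [← Real.rpow_def_of_pos h1, Real.rpow_neg h1.le]; norm_cast
  rw [betaKer, e1, e2, Real.rpow_def_of_pos hx, Real.rpow_def_of_pos (inv_pos.2 h1),
    ofReal_cpow_eq_cexp hx, ofReal_cpow_eq_cexp h0, show (1 : ℂ) - t = ((1 - t : ℝ) : ℂ) by simp,
    ofReal_cpow_eq_cexp h1, Complex.real_smul, Real.log_div h0.ne' h1.ne', Real.log_inv]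
  push_cast
  simp only [← Complex.exp_add]
  congr 1
  ring

lemma integrableOn_betaKer_mul_cpow {a b : ℝ} {s : ℂ} (h : 0 < a + 1 + s.re)
    (hb : a + 1 + s.re < b) :
    IntegrableOn (fun t : ℝ => (betaKer a b t : ℂ) * (t : ℂ) ^ s) (Set.Ioi 0) := by
  rw [integrableOn_Ioi_iff_Ioo]
  have := Complex.betaIntegral_convergent (u := a + 1 + s) (v := b - (a + 1 + s))
    (by simpa using h) (by simpa using hb)
  rw [intervalIntegrable_iff_integrableOn_Ioo_of_le zero_le_one] at this
  exact this.congr_fun (fun t ht => (betaKer_subst ht s).symm) measurableSet_Ioo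

lemma integral_betaKer_mul_cpow {a b : ℝ} {s : ℂ} (h : 0 < a + 1 + s.re)
    (hb : a + 1 + s.re < b) :
    ∫ t in Set.Ioi (0 : ℝ), (betaKer a b t : ℂ) * (t : ℂ) ^ s =
      Complex.Gamma (a + 1 + s) * Complex.Gamma (b - (a + 1 + s)) / Complex.Gamma b := by
  rw [Complex.Gamma_mul_Gamma_eq_betaIntegral (by simpa using h) (by simpa using hb),
    add_sub_cancel, mul_div_cancel_left₀ _ (Complex.Gamma_ne_zero_of_re_pos (by simp; linarith)),
    integral_Ioi_eq_integral_Ioo, Complex.betaIntegral,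
    intervalIntegral.integral_of_le zero_le_one, integral_Ioc_eq_integral_Ioo]
  exact setIntegral_congr_fun measurableSet_Ioo fun t ht => betaKer_subst ht s

lemma integrableOn_mul_rpow_of_cpow {k : ℝ → ℝ} {c : ℝ}
    (h : IntegrableOn (fun t : ℝ => (k t : ℂ) * (t : ℂ) ^ (c : ℂ)) (Set.Ioi 0)) :
    IntegrableOn (fun t => k t * t ^ c) (Set.Ioi 0) := by
  refine IntegrableOn.congr_fun (f := fun t => RCLike.re ((k t : ℂ) * (t : ℂ) ^ (c : ℂ))) h.re
    (fun t (ht : 0 < t) => ?_) measurableSet_Ioi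
  simp only [← Complex.ofReal_cpow ht.le, ← Complex.ofReal_mul]
  simp

theorem mellinRep_gamKer {a c : ℝ} (hc : c < a) :
    MellinRep (gamKer a) (fun s => Complex.Gamma (a - s)) c := by
  refine mellinRep_of_moments (fun x hx => ?_) ?_ (integrable_Gamma_sub_vline hc) fun y => ?_
  · unfold gamKer
    exact (Real.continuousAt_rpow_const _ _ (Or.inl hx.ne')).mul (by fun_prop)
  · exact integrableOn_gamKer_mul_cpow (by simp; linarith)
  · rw [integral_gamKer_mul_cpow (by simp [vline_re]; linarith)]
    congr 1
    ring

theorem mellinRep_betaKer {a b c : ℝ} (hc : c < a) (hb : 0 < b - a + c) :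
    MellinRep (betaKer a b)
      (fun s => Complex.Gamma (a - s) * Complex.Gamma ((b - a : ℝ) + s) / Complex.Gamma b) c := by
  refine mellinRep_of_moments (fun x hx => ?_) ?_
    ((integrable_Gamma_mul_Gamma_vline hc hb).div_const _) fun y => ?_
  · unfold betaKer
    refine (Real.continuousAt_rpow_const _ _ (Or.inl hx.ne')).mul ?_
    exact ContinuousAt.rpow_const (by fun_prop) (Or.inl (by linarith))
  · exact integrableOn_betaKer_mul_cpow (by simp; linarith) (by simp; linarith)
  · rw [integral_betaKer_mul_cpow (by simp [vline_re]; linarith) (by simp [vline_re]; linarith)]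
    push_cast
    congr 2 <;> congr 1 <;> ring

/-! ### Derived representations -/

lemma ae_Ioi_pos : ∀ᵐ t ∂(volume.restrict (Set.Ioi (0 : ℝ))), 0 < t :=
  ae_restrict_mem measurableSet_Ioi

/-- `∫₀^∞ t ^ a (1 + t) ^ (-b) f (x t) dt`. -/
theorem MellinRep.betaAverage {f : ℝ → ℝ} {Φ : ℂ → ℂ} {c a b : ℝ} (h : MellinRep f Φ c)
    (ha : 0 < a + 1 + c) (hb : a + 1 + c < b) :
    MellinRep (fun x => ∫ t in Set.Ioi (0 : ℝ), betaKer a b t * f (x * t))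
      (fun s => Complex.Gamma (a + 1 + s) * Complex.Gamma (b - (a + 1 + s)) / Complex.Gamma b *
        Φ s) c :=
  h.average measurable_id ae_Ioi_pos
    (integrableOn_mul_rpow_of_cpow (integrableOn_betaKer_mul_cpow (by simpa) (by simpa)))
    (fun y => integral_betaKer_mul_cpow (by simpa [vline_re]) (by simpa [vline_re]))

lemma MellinRep.integrableOn_betaAverage {f : ℝ → ℝ} {Φ : ℂ → ℂ} {c a b : ℝ} (h : MellinRep f Φ c)
    (ha : 0 < a + 1 + c) (hb : a + 1 + c < b) {x : ℝ} (hx : 0 < x) :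
    IntegrableOn (fun t => betaKer a b t * f (x * t)) (Set.Ioi 0) :=
  h.integrable_average (X := id) measurable_id ae_Ioi_pos
    (integrableOn_mul_rpow_of_cpow (integrableOn_betaKer_mul_cpow (by simpa) (by simpa))) hx

/-- The upper incomplete Gamma function `∫ₓ^∞ u ^ (a - 1) e ^ (-u) du` for `x > 0`. -/
def upperGam (a x : ℝ) : ℝ := ∫ v in Set.Ioi (1 : ℝ), v⁻¹ * gamKer a (x * v)

/-- Scaling the tail to `v > 1` exhibits it as a dilation average with weight `1 / v`. The moments
`∫₁^∞ v ^ (s - 1) dv = -1 / s` converge exactly for `Re s < 0`. -/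
theorem mellinRep_upperGam {a c : ℝ} (hc : c < a) (h0 : c < 0) :
    MellinRep (upperGam a) (fun s => -1 / s * Complex.Gamma (a - s)) c := by
  have hX0 : ∀ᵐ t ∂(volume.restrict (Set.Ioi (1 : ℝ))), 0 < t := by
    filter_upwards [ae_restrict_mem measurableSet_Ioi] with t ht using one_pos.trans ht
  refine (mellinRep_gamKer hc).average (X := id) (k := fun v => v⁻¹) (Ψ := fun s => -1 / s)
    measurable_id hX0 ?_ fun y => ?_
  · refine IntegrableOn.congr_fun (integrableOn_Ioi_rpow_of_lt (a := c - 1) (by linarith) one_pos)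
      (fun t (ht : 1 < t) => ?_) measurableSet_Ioi
    have ht0 : 0 < t := one_pos.trans ht
    simp only [id, Real.rpow_sub_one ht0.ne']
    ring
  · have hr : (vline c y - 1).re < -1 := by simp [vline_re]; linarith
    have := integral_Ioi_cpow_of_lt hr one_pos
    rw [sub_add_cancel, Complex.ofReal_one, Complex.one_cpow] at this
    rw [← this]
    refine setIntegral_congr_fun measurableSet_Ioi fun t (ht : 1 < t) => ?_
    have ht0 : ((t : ℝ) : ℂ) ≠ 0 := by exact_mod_cast (one_pos.trans ht).ne'
    simp only [id, Complex.cpow_sub _ _ ht0, Complex.cpow_one]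
    push_cast
    ring

/-- The incomplete Beta function `∫₀ˣ u ^ (a - 1) (1 + u) ^ (-b) du` for `x > 0`. -/
def lowerBeta (a b x : ℝ) : ℝ := ∫ v in Set.Ioc (0 : ℝ) 1, v⁻¹ * betaKer a b (x * v)

/-- Here the average runs over `0 < v ≤ 1`, so the moments are `1 / s` and the line has to lie to
the right of 0. -/
theorem mellinRep_lowerBeta {a b c : ℝ} (hc : c < a) (hb : 0 < b - a + c) (h0 : 0 < c) :
    MellinRep (lowerBeta a b) (fun s => 1 / s *
      (Complex.Gamma (a - s) * Complex.Gamma ((b - a : ℝ) + s) / Complex.Gamma b)) c := by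
  have hX0 : ∀ᵐ t ∂(volume.restrict (Set.Ioc (0 : ℝ) 1)), 0 < t := by
    filter_upwards [ae_restrict_mem measurableSet_Ioc] with t ht using ht.1
  refine (mellinRep_betaKer hc hb).average (X := id) (k := fun v => v⁻¹) (Ψ := fun s => 1 / s)
    measurable_id hX0 ?_ fun y => ?_
  · have := intervalIntegral.intervalIntegrable_rpow' (a := 0) (b := 1) (r := c - 1) (by linarith)
    rw [intervalIntegrable_iff_integrableOn_Ioc_of_le zero_le_one] at this
    refine IntegrableOn.congr_fun this (fun t ht => ?_) measurableSet_Ioc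
    simp only [id, Real.rpow_sub_one ht.1.ne']
    ring
  · have hr : -1 < (vline c y - 1).re := by simp [vline_re]; linarith
    have := integral_cpow (a := 0) (b := 1) (Or.inl hr)
    rw [sub_add_cancel, Complex.ofReal_one, Complex.one_cpow, Complex.ofReal_zero,
      Complex.zero_cpow (vline_ne_zero h0.ne' y), sub_zero] at this
    rw [← this, intervalIntegral.integral_of_le zero_le_one]
    refine setIntegral_congr_fun measurableSet_Ioc fun t ht => ?_
    have ht0 : ((t : ℝ) : ℂ) ≠ 0 := by exact_mod_cast ht.1.ne'
    simp only [id, Complex.cpow_sub _ _ ht0, Complex.cpow_one]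
    push_cast
    ring

/-- `∫₀^∞ y ^ a e ^ (-y) f (x / y) dy`. -/
def gamAverage (a : ℝ) (f : ℝ → ℝ) (x : ℝ) : ℝ :=
  ∫ y in Set.Ioi (0 : ℝ), gamKer a y * f (x * y⁻¹)

lemma ofReal_inv_cpow {t : ℝ} (ht : 0 < t) (s : ℂ) : ((t⁻¹ : ℝ) : ℂ) ^ s = (t : ℂ) ^ (-s) := by
  rw [ofReal_cpow_eq_cexp (inv_pos.2 ht), ofReal_cpow_eq_cexp ht, Real.log_inv]
  push_cast
  ring_nf

lemma integrableOn_gamKer_mul_inv_rpow {a c : ℝ} (h : c < a + 1) :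
    IntegrableOn (fun t => gamKer a t * t⁻¹ ^ c) (Set.Ioi 0) := by
  have := integrableOn_mul_rpow_of_cpow (k := gamKer a) (c := -c)
    (integrableOn_gamKer_mul_cpow (by simp; linarith))
  refine this.congr_fun (fun t (ht : 0 < t) => ?_) measurableSet_Ioi
  simp only [Real.inv_rpow ht.le, Real.rpow_neg ht.le]

/-- The dilation factor is `1 / y`, so the Gamma moment is taken at `-s`. -/
theorem MellinRep.gamAverage {f : ℝ → ℝ} {Φ : ℂ → ℂ} {c a : ℝ} (h : MellinRep f Φ c)
    (ha : c < a + 1) :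
    MellinRep (gamAverage a f) (fun s => Complex.Gamma (a + 1 - s) * Φ s) c := by
  refine h.average (X := fun t => t⁻¹) (Ψ := fun s => Complex.Gamma (a + 1 - s)) measurable_inv
    (ae_Ioi_pos.mono fun _ ht => inv_pos.2 ht) (integrableOn_gamKer_mul_inv_rpow ha) fun y => ?_
  rw [sub_eq_add_neg, ← integral_gamKer_mul_cpow (by simp [vline_re]; linarith)]
  refine setIntegral_congr_fun measurableSet_Ioi fun t (ht : 0 < t) => ?_
  simp only [ofReal_inv_cpow ht]

lemma MellinRep.integrableOn_gamAverage {f : ℝ → ℝ} {Φ : ℂ → ℂ} {c a : ℝ} (h : MellinRep f Φ c)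
    (ha : c < a + 1) {x : ℝ} (hx : 0 < x) :
    IntegrableOn (fun y => gamKer a y * f (x * y⁻¹)) (Set.Ioi 0) :=
  h.integrable_average (X := fun t => t⁻¹) measurable_inv
    (ae_Ioi_pos.mono fun _ ht => inv_pos.2 ht) (integrableOn_gamKer_mul_inv_rpow ha) hx

/-! ### The univariate Meijer G-functions -/

lemma Gamma_ofReal_ne_zero {a : ℝ} (ha : 0 < a) : Complex.Gamma a ≠ 0 :=
  Complex.Gamma_ne_zero_of_re_pos (by simpa)

/-- The moments of `betaKer k β` give `Γ(k + 1 + s) Γ(β - k - 1 - s) / Γ(β)` and the exponential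
gives `Γ(-s)`. The separation inequalities are exactly the convergence conditions of these
integrals. -/
theorem meijerG_gamma_kernel (k : ℕ) {β z : ℝ} (hβ : 0 < β) (hz : 0 < z) :
    MeijerGConverges 2 1 [-(k : ℂ)] [(β : ℂ) - k - 1, 0] z ∧
      meijerG 2 1 [-(k : ℂ)] [(β : ℂ) - k - 1, 0] z =
        (Real.Gamma β * ∫ t in Set.Ioi (0 : ℝ), betaKer k β t * gamKer 0 (z * t) : ℝ) ∧
      IntegrableOn (fun t => betaKer k β t * gamKer 0 (z * t)) (Set.Ioi 0) := by
  refine meijerG_of_mellinRep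
    (F := fun z => Real.Gamma β * ∫ t in Set.Ioi (0 : ℝ), betaKer k β t * gamKer 0 (z * t))
    ?_ (fun c hc => ?_) hz
  · obtain ⟨c, h1, h2⟩ := exists_between (show -(k : ℝ) - 1 < min (β - k - 1) 0 from
      lt_min (by linarith) (by linarith [k.cast_nonneg (α := ℝ)]))
    exact ⟨c, by simp [Separates]; exact ⟨by simpa using h2, h1⟩⟩
  · simp [Separates] at hc
    have hf := mellinRep_gamKer (a := 0) hc.1.2
    refine ⟨?_, hf.integrableOn_betaAverage (by linarith) (by linarith) hz⟩
    refine ((hf.betaAverage (a := k) (b := β) (by linarith)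
      (by linarith)).const_mul (Real.Gamma β)).congr (fun _ _ => rfl) fun y => ?_
    have := Gamma_ofReal_ne_zero hβ
    rw [← Complex.Gamma_ofReal]
    simp [gammaQuot]
    field_simp
    ring_nf

theorem meijerG_beta_kernel {m ms β z : ℝ} (hm : 0 < m) (hms : 0 < ms) (hβ : 0 < β) (hz : 0 < z) :
    MeijerGConverges 2 2 [1, 1 - (ms : ℂ)] [(β : ℂ), (m : ℂ)] z ∧
      meijerG 2 2 [1, 1 - (ms : ℂ)] [(β : ℂ), (m : ℂ)] z =
        (Real.Gamma β * Real.Gamma (m + ms) *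
          ∫ t in Set.Ioi (0 : ℝ), betaKer (-1) β t * betaKer m (m + ms) (z * t) : ℝ) ∧
      IntegrableOn (fun t => betaKer (-1) β t * betaKer m (m + ms) (z * t)) (Set.Ioi 0) := by
  refine meijerG_of_mellinRep (F := fun z => Real.Gamma β * Real.Gamma (m + ms) *
      ∫ t in Set.Ioi (0 : ℝ), betaKer (-1) β t * betaKer m (m + ms) (z * t))
    ?_ (fun c hc => ?_) hz
  · obtain ⟨c, h1, h2⟩ := exists_between (show (0 : ℝ) < min β m from lt_min hβ hm)
    exact ⟨c, by simp [Separates]; exact ⟨by simpa using h2, by linarith, by linarith⟩⟩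
  · simp [Separates] at hc
    obtain ⟨⟨h1, h2⟩, h3, h4⟩ := hc
    have hf := mellinRep_betaKer (a := m) (b := m + ms) h2 (by linarith)
    refine ⟨?_, hf.integrableOn_betaAverage (by linarith) (by linarith) hz⟩
    refine ((hf.betaAverage
      (a := -1) (b := β) (by linarith)
      (by linarith)).const_mul (Real.Gamma β * Real.Gamma (m + ms))).congr (fun _ _ => rfl)
      fun y => ?_
    have h5 := Gamma_ofReal_ne_zero hβ
    have h6 := Gamma_ofReal_ne_zero (add_pos hm hms)
    rw [Complex.ofReal_mul, ← Complex.Gamma_ofReal, ← Complex.Gamma_ofReal]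
    simp [gammaQuot] at h6 ⊢
    field_simp

theorem meijerG_upperGam_kernel (k : ℕ) {β z : ℝ} (hβ : 0 < β) (hz : 0 < z) :
    MeijerGConverges 3 1 [0, 1] [(β : ℂ), 0, (k : ℂ) + 1] z ∧
      meijerG 3 1 [0, 1] [(β : ℂ), 0, (k : ℂ) + 1] z = (Real.Gamma (β + 1) *
        ∫ t in Set.Ioi (0 : ℝ), betaKer 0 (β + 1) t * upperGam (k + 1) (z * t) : ℝ) ∧
      IntegrableOn (fun t => betaKer 0 (β + 1) t * upperGam (k + 1) (z * t)) (Set.Ioi 0) := by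
  have hk := k.cast_nonneg (α := ℝ)
  refine meijerG_of_mellinRep (F := fun z => Real.Gamma (β + 1) *
        ∫ t in Set.Ioi (0 : ℝ), betaKer 0 (β + 1) t * upperGam (k + 1) (z * t))
    ?_ (fun c hc => ?_) hz
  -- The separating strip is `-1 < c < 0`, since `β` and `k + 1` are positive.
  · refine ⟨-1 / 2, ?_⟩
    simp [Separates]
    norm_num
    constructor <;> linarith
  · simp [Separates] at hc
    obtain ⟨⟨h1, h2, h3⟩, h4⟩ := hc
    have hf := mellinRep_upperGam (a := k + 1) h3 h2
    refine ⟨?_, hf.integrableOn_betaAverage (by linarith) (by linarith) hz⟩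
    refine ((hf.betaAverage
      (a := 0) (b := β + 1) (by linarith)
      (by linarith)).const_mul (Real.Gamma (β + 1))).congr (fun _ _ => rfl)
      fun y => ?_
    have h5 := Gamma_ofReal_ne_zero (show 0 < β + 1 by linarith)
    have h6 : Complex.Gamma (1 - vline c y) ≠ 0 :=
      Complex.Gamma_ne_zero_of_re_pos (by simp [vline_re]; linarith)
    have h7 := vline_ne_zero h2.ne y
    -- The lower parameter 0 and the upper parameter 1 together contribute `Γ(-s) / Γ(1 - s) = -1 /
    -- s`, the factor coming from `upperGam`.
    have h8 : Complex.Gamma (1 - vline c y) = -vline c y * Complex.Gamma (-vline c y) := by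
      rw [← Complex.Gamma_add_one _ (neg_ne_zero.2 h7)]; ring_nf
    rw [← Complex.Gamma_ofReal]
    simp [gammaQuot] at h5 ⊢
    have h9 : Complex.Gamma (-vline c y) ≠ 0 := fun h => h6 (by rw [h8, h, mul_zero])
    rw [h8, show (β : ℂ) + 1 - (1 + vline c y) = β - vline c y by ring]
    field_simp

/-! ### The bivariate Meijer G-functions -/

lemma MellinRep.integrableOn_betaBivariate {f g : ℝ → ℝ} {Φ Φ₂ : ℂ → ℂ} {c c₂ a b : ℝ}
    (h : MellinRep f Φ c) (h₂ : MellinRep g Φ₂ c₂) (ha : 0 < a + 1 + (c + c₂))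
    (hb : a + 1 + (c + c₂) < b) {z w : ℝ} (hz : 0 < z) (hw : 0 < w) :
    IntegrableOn (fun t => betaKer a b t * (f (z * t) * g (w * t))) (Set.Ioi 0) :=
  h.integrable_bivariate_average h₂ (X := id) measurable_id ae_Ioi_pos
    (integrableOn_mul_rpow_of_cpow (integrableOn_betaKer_mul_cpow
      (by simpa using ha) (by simpa using hb))) hz hw

/-- The weight `betaKer a b` always furnishes the outer block, and `f`, `g` the inner ones. What
each application must supply is the Gamma identity `hK`, with `K` absorbing the constant
denominators. -/
theorem MellinRep.betaBivariate {f g : ℝ → ℝ} {Φ Φ₂ : ℂ → ℂ} {c c₂ a b : ℝ}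
    (h : MellinRep f Φ c) (h₂ : MellinRep g Φ₂ c₂) (ha : 0 < a + 1 + (c + c₂))
    (hb : a + 1 + (c + c₂) < b) {z w : ℝ} (hz : 0 < z) (hw : 0 < w)
    {o u v : GBlock} (K : ℝ)
    (hK : ∀ s t : ℂ, s.re = c → t.re = c₂ →
      K * (Complex.Gamma (a + 1 + (s + t)) * Complex.Gamma (b - (a + 1 + (s + t))) /
        Complex.Gamma b * Φ s * Φ₂ t) =
      gammaQuot o.m o.n o.a o.b (s + t) * gammaQuot u.m u.n u.a u.b s *
        gammaQuot v.m v.n v.a v.b t) :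
    Integrable (meijer2Integrand o u v z w c c₂) ∧ meijer2Line o u v z w c c₂ =
      (K * ∫ t in Set.Ioi (0 : ℝ), betaKer a b t * (f (z * t) * g (w * t)) : ℝ) ∧
      IntegrableOn (fun t => betaKer a b t * (f (z * t) * g (w * t))) (Set.Ioi 0) := by
  obtain ⟨h3, h4⟩ := h.bivariate h₂ (X := id) (k := betaKer a b) (Ψ := fun s =>
      Complex.Gamma (a + 1 + s) * Complex.Gamma (b - (a + 1 + s)) / Complex.Gamma b)
    measurable_id ae_Ioi_pos
    (integrableOn_mul_rpow_of_cpow (integrableOn_betaKer_mul_cpow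
      (by simpa using ha) (by simpa using hb)))
    (fun y => integral_betaKer_mul_cpow (by simpa [vline_re]) (by simpa [vline_re])) hz hw
  have e : ∀ y, meijer2Integrand o u v z w c c₂ y = K * _ := fun y => by
    rw [meijer2Integrand, ← hK _ _ (vline_re c y.1) (vline_re c₂ y.2), mul_assoc, mul_assoc]
  have e' := funext e
  refine ⟨?_, ?_, h.integrableOn_betaBivariate h₂ ha hb hz hw⟩
  · rw [e']
    refine (h3.const_mul (K : ℂ)).congr (.of_forall fun y => ?_)
    simp only [mul_assoc]
  · rw [meijer2Line, e', Complex.ofReal_mul]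
    simp only [id] at h4
    rw [← h4, integral_const_mul]
    simp only [mul_assoc]
    ring

namespace RelayParams

variable (p : RelayParams)

lemma β_pos : 0 < p.β :=
  div_pos (mul_pos (mul_pos p.B_pos p.T_pos) p.θ_pos) (Real.log_pos one_lt_two)

lemma A_pos : 0 < p.A :=
  div_pos (mul_pos p.m_pos p.Ωs_pos) (mul_pos (mul_pos p.ms_pos p.Ωm_pos) p.gRU_pos)

lemma exists_lines_M2 (k i : ℕ) (hik : i ≤ k) :
    ∃ c : ℝ × ℝ, -1 < c.1 + c.2 ∧ c.1 + c.2 < p.β ∧ c.1 < (k : ℝ) - i ∧ 0 < c.2 ∧ c.2 < p.m ∧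
      c.2 < 1 + i := by
  have h1 : (0 : ℝ) ≤ (k : ℝ) - i := sub_nonneg.2 (by exact_mod_cast hik)
  have h2 := i.cast_nonneg (α := ℝ)
  have h3 := p.β_pos
  obtain ⟨c, h4, h5⟩ := exists_between (show (0 : ℝ) < min p.m (1 / 2) from
    lt_min p.m_pos (by norm_num))
  rw [lt_min_iff] at h5
  -- With `0 < c < 1 / 2` the sum lies in `(-1 / 2, 0)`, which suits the outer block whatever `β >
  -- 0` is.
  refine ⟨(-1 / 2, c), ?_, ?_, ?_, h4, h5.1, ?_⟩ <;> dsimp only <;> linarith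

theorem meijerG2_M2 (k i : ℕ) (hik : i ≤ k) {z w : ℝ} (hz : 0 < z) (hw : 0 < w) :
    MeijerG2Converges p.blockM2o (blockM2u k i) (p.blockM2v i) z w ∧
      meijerG2 p.blockM2o (blockM2u k i) (p.blockM2v i) z w =
        (Real.Gamma (p.β + 1) * Real.Gamma (p.m + p.ms) * ∫ t in Set.Ioi (0 : ℝ),
          betaKer 0 (p.β + 1) t * (gamKer ((k : ℝ) - i) (z * t) *
            gamAverage i (lowerBeta p.m (p.m + p.ms)) (w * t)) : ℝ) ∧
      IntegrableOn (fun t => betaKer 0 (p.β + 1) t * (gamKer ((k : ℝ) - i) (z * t) *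
        gamAverage i (lowerBeta p.m (p.m + p.ms)) (w * t))) (Set.Ioi 0) := by
  have hβ := p.β_pos
  have hms := p.ms_pos
  have hm := p.m_pos
  refine meijerG2_of_lines ?_ fun c₁ c₂ hc => ?_
  · obtain ⟨c, h1, h2, h3, h4, h5, h6⟩ := p.exists_lines_M2 k i hik
    refine ⟨c, ?_⟩
    simp [Separates2, Separates, blockM2o, blockM2u, blockM2v]
    exact ⟨⟨h2, h1⟩, h3, ⟨h5, h6⟩, by linarith, h4⟩
  · simp [Separates2, Separates, blockM2o, blockM2u, blockM2v] at hc
    obtain ⟨⟨h2, h1⟩, h3, ⟨h5, h6⟩, h7, h4⟩ := hc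
    refine MellinRep.betaBivariate (mellinRep_gamKer h3)
      ((mellinRep_lowerBeta (a := p.m) (b := p.m + p.ms) h5 (by linarith) h4).gamAverage
        (a := i) (by linarith)) (by linarith) (by linarith) hz hw _ fun s t hs ht => ?_
    have g1 := Gamma_ofReal_ne_zero (show 0 < p.β + 1 by linarith)
    have g2 := Gamma_ofReal_ne_zero (add_pos hm hms)
    have g3 : t ≠ 0 := fun h => by simp [h] at ht; linarith
    have g4 : Complex.Gamma t ≠ 0 := Complex.Gamma_ne_zero_of_re_pos (by linarith)
    rw [Complex.ofReal_mul, ← Complex.Gamma_ofReal, ← Complex.Gamma_ofReal]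
    simp [gammaQuot, blockM2o, blockM2u, blockM2v] at g1 g2 ⊢
    -- The third block contains `Γ(t) / Γ(1 + t) = 1 / t`, the factor of `lowerBeta`; `gamAverage`
    -- accounts for `Γ(1 + i - t)`.
    rw [show (p.β : ℂ) + 1 - (1 + (s + t)) = p.β - (s + t) by ring, add_comm (1 : ℂ) t,
      Complex.Gamma_add_one _ g3, add_comm (i : ℂ) 1]
    field_simp

theorem meijerG2_N1 (k : ℕ) {z w : ℝ} (hz : 0 < z) (hw : 0 < w) :
    MeijerG2Converges (p.blockN1o k) blockN1u p.blockN1v z w ∧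
      meijerG2 (p.blockN1o k) blockN1u p.blockN1v z w =
        (Real.Gamma p.β * Real.Gamma (p.m + p.ms) * ∫ t in Set.Ioi (0 : ℝ),
          betaKer k p.β t * (gamKer 0 (z * t) * lowerBeta p.m (p.m + p.ms) (w * t)) : ℝ) ∧
      IntegrableOn (fun t => betaKer k p.β t * (gamKer 0 (z * t) *
        lowerBeta p.m (p.m + p.ms) (w * t))) (Set.Ioi 0) := by
  have hβ := p.β_pos
  have hms := p.ms_pos
  have hm := p.m_pos
  have hk := k.cast_nonneg (α := ℝ)
  refine meijerG2_of_lines ?_ fun c₁ c₂ hc => ?_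
  · obtain ⟨c, h4, h5⟩ := exists_between (show (0 : ℝ) < min p.m (1 / 2) from
      lt_min p.m_pos (by norm_num))
    -- The outer block restricts only the sum of the abscissas, so the sum `e` is chosen first;
    -- being negative, it also makes `e - c` negative.
    obtain ⟨e, h6, h7⟩ := exists_between (show -(k : ℝ) - 1 < min (p.β - k - 1) (-1 / 2) from
      lt_min (by linarith) (by linarith))
    rw [lt_min_iff] at h5 h7
    refine ⟨(e - c, c), ?_⟩
    simp [Separates2, Separates, blockN1o, blockN1u, blockN1v]
    exact ⟨⟨by linarith, h6⟩, by linarith, h5.1, by linarith, h4⟩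
  · simp [Separates2, Separates, blockN1o, blockN1u, blockN1v] at hc
    obtain ⟨⟨h2, h1⟩, h3, h5, h7, h4⟩ := hc
    refine MellinRep.betaBivariate (mellinRep_gamKer h3)
      (mellinRep_lowerBeta (a := p.m) (b := p.m + p.ms) h5 (by linarith) h4)
      (by linarith) (by linarith) hz hw _ fun s t hs ht => ?_
    have g1 := Gamma_ofReal_ne_zero hβ
    have g2 := Gamma_ofReal_ne_zero (add_pos hm hms)
    have g3 : t ≠ 0 := fun h => by simp [h] at ht; linarith
    have g4 : Complex.Gamma t ≠ 0 := Complex.Gamma_ne_zero_of_re_pos (by linarith)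
    rw [Complex.ofReal_mul, ← Complex.Gamma_ofReal, ← Complex.Gamma_ofReal]
    simp [gammaQuot, blockN1o, blockN1u, blockN1v] at g1 g2 ⊢
    rw [show -(k : ℂ) - 1 + p.β - (s + t) = p.β - (k + 1 + (s + t)) by ring,
      add_comm (1 : ℂ) t, Complex.Gamma_add_one _ g3, add_comm (k : ℂ) 1]
    field_simp

theorem meijerG2_N2 (k : ℕ) {z w : ℝ} (hz : 0 < z) (hw : 0 < w) :
    MeijerG2Converges p.blockN2o p.blockN2u (blockN2v k) z w ∧
      meijerG2 p.blockN2o p.blockN2u (blockN2v k) z w =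
        (Real.Gamma p.β * Real.Gamma (p.m + p.ms) * ∫ t in Set.Ioi (0 : ℝ),
          betaKer (p.m - 1) p.β t *
            (betaKer 0 (p.m + p.ms) (z * t) * upperGam (k + 1) (w * t)) : ℝ) ∧
      IntegrableOn (fun t => betaKer (p.m - 1) p.β t *
        (betaKer 0 (p.m + p.ms) (z * t) * upperGam (k + 1) (w * t))) (Set.Ioi 0) := by
  have hβ := p.β_pos
  have hms := p.ms_pos
  have hm := p.m_pos
  have hk := k.cast_nonneg (α := ℝ)
  refine meijerG2_of_lines ?_ fun c₁ c₂ hc => ?_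
  · obtain ⟨e, h6, h7⟩ := exists_between (show -p.m < min (p.β - p.m) 0 from
      lt_min (by linarith) (by linarith))
    rw [lt_min_iff] at h7
    -- Both inner blocks want a negative abscissa, so the sum is shared equally; `e / 2 > -m` then
    -- leaves the first inner block satisfied.
    refine ⟨(e / 2, e / 2), ?_⟩
    simp [Separates2, Separates, blockN2o, blockN2u, blockN2v]
    refine ⟨⟨by linarith, by linarith⟩, ⟨by linarith, by linarith⟩, by linarith, by linarith⟩
  · simp [Separates2, Separates, blockN2o, blockN2u, blockN2v] at hc
    obtain ⟨⟨h2, h1⟩, ⟨h3, h4⟩, h5, h6⟩ := hc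
    refine MellinRep.betaBivariate (mellinRep_betaKer (b := p.m + p.ms) h3 (by linarith))
      (mellinRep_upperGam h6 h5)
      (by linarith) (by linarith) hz hw _ fun s t hs ht => ?_
    have g1 := Gamma_ofReal_ne_zero hβ
    have g2 := Gamma_ofReal_ne_zero (add_pos hm hms)
    have g3 : t ≠ 0 := fun h => by simp [h] at ht; linarith
    have g4 : Complex.Gamma (-t) ≠ 0 := Complex.Gamma_ne_zero_of_re_pos (by simp; linarith)
    have g5 : Complex.Gamma (1 - t) = -t * Complex.Gamma (-t) := by
      rw [← Complex.Gamma_add_one _ (neg_ne_zero.2 g3)]; ring_nf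
    rw [Complex.ofReal_mul, ← Complex.Gamma_ofReal, ← Complex.Gamma_ofReal]
    simp [gammaQuot, blockN2o, blockN2u, blockN2v] at g1 g2 ⊢
    rw [show (p.β : ℂ) - p.m - (s + t) = p.β - (p.m + (s + t)) by ring, g5,
      show 1 - (1 - (p.m : ℂ) - p.ms) + s = p.m + p.ms + s by ring]
    field_simp

end RelayParams

/-! ### Kummer's transformation for an integer parameter -/

/-- The coefficient on the left is `(N + n).choose n / n!`. Vandermonde expands it into the sum of
`N.choose k / (k! l!)` over `k + l = n`, a Cauchy product with the exponential series; `N.choose k =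
0` for `k > N` makes the other factor a polynomial. -/
theorem hyp1F1_nat_succ_one (N : ℕ) (x : ℝ) :
    hyp1F1 ((N + 1 : ℕ) : ℝ) 1 x =
      (∑ k ∈ Finset.range (N + 1), (N.choose k : ℝ) * (x ^ k / k.factorial)) * Real.exp x := by
  have h0 : ∀ k ∉ Finset.range (N + 1), (N.choose k : ℝ) * (x ^ k / k.factorial) = 0 := by
    intro k hk
    rw [Nat.choose_eq_zero_of_lt (by simpa [Nat.lt_succ_iff] using hk)]
    simp
  have hf : Summable fun k : ℕ => ‖(N.choose k : ℝ) * (x ^ k / k.factorial)‖ :=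
    summable_of_ne_finset_zero (s := Finset.range (N + 1)) fun k hk => by rw [h0 k hk, norm_zero]
  have hg : Summable fun k : ℕ => ‖x ^ k / (k.factorial : ℝ)‖ :=
    (Real.summable_pow_div_factorial x).norm
  rw [← tsum_eq_sum (L := .unconditional ℕ) h0, Real.exp_eq_exp_ℝ, NormedSpace.exp_eq_tsum_div,
    tsum_mul_tsum_eq_tsum_sum_antidiagonal_of_summable_norm hf hg, hyp1F1]
  refine tsum_congr fun n => ?_
  have hn : (n.factorial : ℝ) ≠ 0 := by exact_mod_cast n.factorial_ne_zero
  rw [ascPochhammer_eval_one, ← Nat.cast_ascFactorial, Nat.ascFactorial_eq_factorial_mul_choose,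
    Nat.cast_mul, mul_div_cancel_left₀ _ hn, Nat.add_choose_eq, Nat.cast_sum, Finset.sum_mul]
  refine Finset.sum_congr rfl fun kl hkl => ?_
  rw [Finset.HasAntidiagonal.mem_antidiagonal] at hkl
  obtain ⟨k, l⟩ := kl
  simp only at hkl ⊢
  subst hkl
  have hk : (k.factorial : ℝ) ≠ 0 := by exact_mod_cast k.factorial_ne_zero
  have hl : (l.factorial : ℝ) ≠ 0 := by exact_mod_cast l.factorial_ne_zero
  have hc : (((k + l).choose l : ℕ) : ℝ) * k.factorial * l.factorial = (k + l).factorial := by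
    have := Nat.add_choose_mul_factorial_mul_factorial k l
    exact_mod_cast this
  have hcl : (((k + l).choose l : ℕ) : ℝ) ≠ 0 := by
    exact_mod_cast (Nat.choose_pos (Nat.le_add_left l k)).ne'
  push_cast
  rw [← hc] at hn ⊢
  field_simp
  ring

lemma neg_one_pow_mul_ascPochhammer (N k : ℕ) :
    (-1) ^ k * (ascPochhammer ℝ k).eval (1 - ((N + 1 : ℕ) : ℝ)) = k.factorial * N.choose k := by
  rw [show 1 - ((N + 1 : ℕ) : ℝ) = -(N : ℝ) by push_cast; ring,
    ascPochhammer_eval_neg_eq_descPochhammer, descPochhammer_eval_eq_descFactorial,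
    Nat.descFactorial_eq_factorial_mul_choose, ← mul_assoc, ← mul_pow]
  simp

/-! ### Incomplete Gamma and Beta functions -/

lemma continuous_gamKer_nat (k : ℕ) : Continuous (gamKer k) := by
  unfold gamKer
  simp only [Real.rpow_natCast]
  fun_prop

lemma gamKer_nonneg {a x : ℝ} (hx : 0 ≤ x) : 0 ≤ gamKer a x := by
  unfold gamKer; positivity

lemma betaKer_nonneg {a b x : ℝ} (hx : 0 ≤ x) : 0 ≤ betaKer a b x := by
  unfold betaKer; positivity

lemma gamKer_add_one {a u : ℝ} (hu : 0 < u) : gamKer (a + 1) u = u * gamKer a u := by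
  rw [gamKer, gamKer, Real.rpow_add_one hu.ne']; ring

lemma integrableOn_gamKer {a : ℝ} (ha : 0 < a + 1) : IntegrableOn (gamKer a) (Set.Ioi 0) := by
  have := integrableOn_mul_rpow_of_cpow (k := gamKer a) (c := 0)
    (integrableOn_gamKer_mul_cpow (by simpa))
  simpa using this

lemma integral_gamKer {a : ℝ} (ha : 0 < a + 1) :
    ∫ u in Set.Ioi (0 : ℝ), gamKer a u = Real.Gamma (a + 1) := by
  have := integral_gamKer_mul_cpow (a := a) (s := 0) (by simpa)
  simp only [Complex.cpow_zero, mul_one, add_zero] at this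
  rw [integral_complex_ofReal, show (a : ℂ) + 1 = ((a + 1 : ℝ) : ℂ) by simp,
    Complex.Gamma_ofReal] at this
  exact_mod_cast this

lemma upperGam_eq_integral {a y : ℝ} (hy : 0 < y) :
    upperGam (a + 1) y = ∫ u in Set.Ioi y, gamKer a u := by
  have := integral_comp_mul_left_Ioi' (gamKer a) 1 hy
  rw [mul_one] at this
  rw [← this, smul_eq_mul, ← integral_const_mul, upperGam]
  refine setIntegral_congr_fun measurableSet_Ioi fun v (hv : 1 < v) => ?_
  have hv0 : 0 < v := one_pos.trans hv
  simp only [gamKer_add_one (mul_pos hy hv0)]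
  field_simp

lemma integral_Ioc_gamKer_mul {a r x : ℝ} (ha : 0 < a + 1) (hr : 0 < r) (hx : 0 < x) :
    ∫ u in Set.Ioc 0 x, r * gamKer a (r * u) = Real.Gamma (a + 1) - upperGam (a + 1) (r * x) := by
  have hrx : 0 < r * x := mul_pos hr hx
  have h1 : ∫ u in Set.Ioc 0 x, r * gamKer a (r * u) = ∫ u in Set.Ioc 0 (r * x), gamKer a u := by
    rw [← intervalIntegral.integral_of_le hx.le, ← intervalIntegral.integral_of_le hrx.le,
      intervalIntegral.integral_const_mul, intervalIntegral.mul_integral_comp_mul_left, mul_zero]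
  have h2 := integrableOn_gamKer ha
  rw [h1, ← integral_gamKer ha, upperGam_eq_integral hrx, ← Set.Ioc_union_Ioi_eq_Ioi hrx.le,
    setIntegral_union (Set.Ioc_disjoint_Ioi le_rfl) measurableSet_Ioi
      (h2.mono_set Set.Ioc_subset_Ioi_self) (h2.mono_set (Set.Ioi_subset_Ioi hrx.le))]
  ring

lemma lowerBeta_mul_eq_integral {a b A x : ℝ} (hx : 0 < x) :
    lowerBeta a b (A * x) = ∫ u in Set.Ioc 0 x, u⁻¹ * betaKer a b (A * u) := by
  have := intervalIntegral.mul_integral_comp_mul_left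
    (f := fun u => u⁻¹ * betaKer a b (A * u)) (a := 0) (b := 1) x
  rw [mul_zero, mul_one, intervalIntegral.integral_of_le zero_le_one,
    intervalIntegral.integral_of_le hx.le] at this
  rw [← this, lowerBeta, ← integral_const_mul]
  refine setIntegral_congr_fun measurableSet_Ioc fun v hv => ?_
  have := hv.1
  rw [mul_assoc A x v]
  field_simp

/-! ### Laws with densities on the half-line -/

lemma densityLaw_map {f h φ φ' : ℝ → ℝ} (hφ : Measurable φ)
    (himg : φ '' Set.Ioi 0 = Set.Ioi 0) (hinj : Set.InjOn φ (Set.Ioi 0))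
    (hd : ∀ x ∈ Set.Ioi (0 : ℝ), HasDerivWithinAt φ (φ' x) (Set.Ioi 0) x)
    (hf : ∀ x, 0 < x → f x = |φ' x| * h (φ x)) :
    (densityLaw f).map φ = densityLaw h := by
  ext s hs
  rw [Measure.map_apply hφ hs, densityLaw, densityLaw, withDensity_apply _ (hφ hs),
    withDensity_apply _ hs, ← lintegral_indicator (hφ hs), ← lintegral_indicator hs]
  conv_rhs => rw [← himg]
  rw [lintegral_image_eq_lintegral_abs_deriv_mul measurableSet_Ioi hd hinj]
  refine setLIntegral_congr_fun measurableSet_Ioi fun x hx => ?_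
  by_cases hxs : φ x ∈ s
  · rw [Set.indicator_of_mem hxs, Set.indicator_of_mem (by exact hxs), hf x hx,
      ENNReal.ofReal_mul (abs_nonneg _)]
  · rw [Set.indicator_of_notMem hxs, Set.indicator_of_notMem (by exact hxs), mul_zero]

lemma integral_densityLaw {f : ℝ → ℝ} (hf : Measurable f) (h0 : ∀ x, 0 < x → 0 ≤ f x)
    (g : ℝ → ℝ) : ∫ x, g x ∂densityLaw f = ∫ x in Set.Ioi (0 : ℝ), f x * g x := by
  rw [densityLaw, integral_withDensity_eq_integral_toReal_smul hf.ennreal_ofReal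
    (.of_forall fun _ => ENNReal.ofReal_lt_top)]
  refine setIntegral_congr_fun measurableSet_Ioi fun x hx => ?_
  simp only [ENNReal.toReal_ofReal (h0 x hx), smul_eq_mul]

lemma integrable_densityLaw_iff {f : ℝ → ℝ} (hf : Measurable f) (h0 : ∀ x, 0 < x → 0 ≤ f x)
    {g : ℝ → ℝ} : Integrable g (densityLaw f) ↔
      IntegrableOn (fun x => f x * g x) (Set.Ioi 0) := by
  rw [densityLaw, integrable_withDensity_iff_integrable_smul' hf.ennreal_ofReal
    (.of_forall fun _ => ENNReal.ofReal_lt_top)]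
  refine integrableOn_congr_fun (fun x hx => ?_) measurableSet_Ioi
  simp only [ENNReal.toReal_ofReal (h0 x hx), smul_eq_mul]

lemma ae_pos_densityLaw (f : ℝ → ℝ) : ∀ᵐ x ∂densityLaw f, 0 < x :=
  (withDensity_absolutelyContinuous _ _).ae_le ae_Ioi_pos

lemma densityLaw_real_Iic {f : ℝ → ℝ} (hf : Measurable f) (h0 : ∀ x, 0 < x → 0 ≤ f x) (x : ℝ) :
    (densityLaw f).real (Set.Iic x) = ∫ u in Set.Ioc 0 x, f u := by
  rw [measureReal_def, densityLaw, withDensity_apply _ measurableSet_Iic,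
    Measure.restrict_restrict measurableSet_Iic, Set.inter_comm, Set.Ioi_inter_Iic,
    integral_eq_lintegral_of_nonneg_ae _ hf.aestronglyMeasurable]
  filter_upwards [ae_restrict_mem measurableSet_Ioc] with u hu using h0 u hu.1

/-! ### Densities and distribution functions of the links -/

namespace RelayParams

variable (p : RelayParams)

lemma βSR_sub_δSR_pos : 0 < p.βSR - p.δSR := by
  have h1 := p.bs_pos
  have h2 := p.Ωsr_nonneg
  have h3 : (0 : ℝ) < p.Γs := by exact_mod_cast p.Γs_pos
  have h4 : 0 < 2 * p.bs * p.Γs := by positivity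
  have : p.βSR - p.δSR = p.Γs / (2 * p.bs * p.Γs + p.Ωsr) := by
    rw [βSR, δSR]
    field_simp
    ring
  rw [this]
  positivity

lemma rSR_pos : 0 < p.rSR := div_pos p.βSR_sub_δSR_pos p.gSR_pos

lemma δSR_nonneg : 0 ≤ p.δSR := by
  have h1 := p.bs_pos
  have h2 := p.Ωsr_nonneg
  rw [δSR]; positivity

lemma αSR_nonneg : 0 ≤ p.αSR := by
  have h1 := p.bs_pos
  have h2 := p.Ωsr_nonneg
  rw [αSR]; positivity

/-- The weight `α_SR c_k / (β_SR - δ_SR) ^ (k + 1)`. -/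
def wSR (k : ℕ) : ℝ := p.αSR * p.c k / (p.βSR - p.δSR) ^ (k + 1)

lemma c_eq {N : ℕ} (hN : p.Γs = N + 1) (k : ℕ) :
    p.c k = N.choose k * p.δSR ^ k / k.factorial := by
  have hk : (k.factorial : ℝ) ≠ 0 := by exact_mod_cast k.factorial_ne_zero
  rw [c, hN, neg_one_pow_mul_ascPochhammer]
  field_simp

lemma exists_Γs_eq : ∃ N, p.Γs = N + 1 := ⟨p.Γs - 1, by have := p.Γs_pos; omega⟩

lemma wSR_nonneg (k : ℕ) : 0 ≤ p.wSR k := by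
  obtain ⟨N, hN⟩ := p.exists_Γs_eq
  have h1 := p.βSR_sub_δSR_pos
  have h2 := p.δSR_nonneg
  have h3 := p.αSR_nonneg
  rw [wSR, p.c_eq hN]
  positivity

lemma gSR_wSR (k : ℕ) : p.αSR * p.c k / p.gSR ^ (k + 1) = p.wSR k * p.rSR ^ (k + 1) := by
  have h1 := p.βSR_sub_δSR_pos
  have h2 := p.gSR_pos
  rw [wSR, rSR, div_pow]
  field_simp

/-- Kummer's exponential merges with the original one into the rate `rSR`, so the law is a finite
combination of Erlang densities, normalized only up to `k!`. -/
theorem pdfSR_eq (x : ℝ) : p.pdfSR x =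
    ∑ k ∈ Finset.range p.Γs, p.wSR k * (p.rSR * gamKer k (p.rSR * x)) := by
  obtain ⟨N, hN⟩ := p.exists_Γs_eq
  have hg := p.gSR_pos
  have he : Real.exp (-p.βSR * (x / p.gSR)) * Real.exp (p.δSR * (x / p.gSR)) =
      Real.exp (-(p.rSR * x)) := by
    rw [← Real.exp_add, rSR]; congr 1; field_simp; ring
  have h1 : p.pdfSR x = p.αSR / p.gSR * (∑ k ∈ Finset.range (N + 1),
      (N.choose k : ℝ) * ((p.δSR * (x / p.gSR)) ^ k / k.factorial)) *
        Real.exp (-(p.rSR * x)) := by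
    rw [pdfSR, pdfPowerSR, hN, hyp1F1_nat_succ_one, ← he]; ring
  rw [h1, hN, Finset.mul_sum, Finset.sum_mul]
  refine Finset.sum_congr rfl fun k _ => ?_
  have h2 := p.gSR_wSR k
  have : p.wSR k * (p.rSR * gamKer k (p.rSR * x)) =
      (p.wSR k * p.rSR ^ (k + 1)) * (x ^ k * Real.exp (-(p.rSR * x))) := by
    rw [gamKer, Real.rpow_natCast]; ring
  rw [this, ← h2, p.c_eq hN, mul_pow, div_pow]
  field_simp
  ring

lemma measurable_pdfSR : Measurable p.pdfSR := by
  have := fun k => (continuous_gamKer_nat k).measurable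
  rw [show p.pdfSR = fun x => _ from funext p.pdfSR_eq]
  fun_prop

lemma pdfSR_nonneg (x : ℝ) (hx : 0 < x) : 0 ≤ p.pdfSR x := by
  rw [pdfSR_eq]
  refine Finset.sum_nonneg fun k _ => mul_nonneg (p.wSR_nonneg k)
    (mul_nonneg p.rSR_pos.le (gamKer_nonneg (mul_nonneg p.rSR_pos.le hx.le)))

lemma beta_m_ms_pos : 0 < beta p.m p.ms := beta_pos p.m_pos p.ms_pos

/-- With `D = ms * Ωm * gRU` one has `m * Ωs = A * D`, and all powers of `D` cancel. -/
theorem pdfRU_eq {x : ℝ} (hx : 0 < x) :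
    p.pdfRU x = 1 / beta p.m p.ms * (x⁻¹ * betaKer p.m (p.m + p.ms) (p.A * x)) := by
  have hB := p.beta_m_ms_pos
  have hD : 0 < p.ms * p.Ωm * p.gRU := mul_pos (mul_pos p.ms_pos p.Ωm_pos) p.gRU_pos
  have hE : 0 < p.m * p.Ωs := mul_pos p.m_pos p.Ωs_pos
  have hA := p.A_pos
  have e1 : p.m * p.Ωs = p.A * (p.ms * p.Ωm * p.gRU) := by rw [A, div_mul_cancel₀ _ hD.ne']
  set D := p.ms * p.Ωm * p.gRU with hDdef
  have e2 : p.m * p.Ωs * x + D = D * (1 + p.A * x) := by rw [e1]; ring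
  have h1 : 0 < 1 + p.A * x := by positivity
  rw [pdfRU, ← hDdef, e2, e1, betaKer, Real.mul_rpow hA.le hD.le, Real.mul_rpow hD.le h1.le,
    Real.rpow_sub_one hx.ne', Real.rpow_neg h1.le, Real.mul_rpow hA.le hx.le, Real.rpow_add hD]
  have := Real.rpow_pos_of_pos hD p.m
  have := Real.rpow_pos_of_pos hD p.ms
  have := Real.rpow_pos_of_pos h1 (p.m + p.ms)
  field_simp

lemma measurable_pdfRU : Measurable p.pdfRU := by
  unfold pdfRU; fun_prop

lemma pdfRU_nonneg (x : ℝ) (hx : 0 < x) : 0 ≤ p.pdfRU x := by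
  rw [p.pdfRU_eq hx]
  have := p.beta_m_ms_pos
  have h2 := betaKer_nonneg (a := p.m) (b := p.m + p.ms) (mul_pos p.A_pos hx).le
  positivity

lemma integral_Ioc_pdfSR {x : ℝ} (hx : 0 < x) : ∫ u in Set.Ioc 0 x, p.pdfSR u =
    ∑ k ∈ Finset.range p.Γs,
      p.wSR k * (Real.Gamma (k + 1) - upperGam (k + 1) (p.rSR * x)) := by
  simp only [pdfSR_eq]
  rw [integral_finsetSum]
  · refine Finset.sum_congr rfl fun k _ => ?_
    rw [integral_const_mul, integral_Ioc_gamKer_mul (by positivity) p.rSR_pos hx]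
  · intro k _
    have := continuous_gamKer_nat k
    exact (Continuous.integrableOn_Icc (by fun_prop)).mono_set Set.Ioc_subset_Icc_self

lemma integral_Ioc_pdfRU {x : ℝ} (hx : 0 < x) : ∫ u in Set.Ioc 0 x, p.pdfRU u =
    1 / beta p.m p.ms * lowerBeta p.m (p.m + p.ms) (p.A * x) := by
  rw [lowerBeta_mul_eq_integral hx, ← integral_const_mul]
  exact setIntegral_congr_fun measurableSet_Ioc fun u hu => p.pdfRU_eq hu.1

end RelayParams

lemma linkSNR_nonneg {Ω : Type*} {g : ℝ} (hg : 0 < g) (h : Ω → ℂ) (ω : Ω) : 0 ≤ linkSNR g h ω := by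
  unfold linkSNR; positivity

section Laws

variable {Ω : Type*} [MeasurableSpace Ω] {P : Measure Ω} {p : RelayParams} {hSR hRU : Ω → ℂ}

lemma measurable_linkSNR {h : Ω → ℂ} (hh : Measurable h) (g : ℝ) : Measurable (linkSNR g h) := by
  unfold linkSNR; fun_prop

theorem IsRelayChannel.map_linkSNR_SR (hch : IsRelayChannel p P hSR hRU) :
    P.map (linkSNR p.gSR hSR) = densityLaw p.pdfSR := by
  have hg := p.gSR_pos
  have : linkSNR p.gSR hSR = (fun x => p.gSR * x) ∘ fun ω => ‖hSR ω‖ ^ 2 := rfl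
  have hm := hch.measurable_SR
  rw [this, ← Measure.map_map (by fun_prop) (by fun_prop), hch.law_SR]
  refine densityLaw_map (φ' := fun _ => p.gSR) (by fun_prop) ?_ ?_ ?_ fun x hx => ?_
  · rw [Set.image_mul_left_Ioi hg, mul_zero]
  · exact fun x _ y _ h => mul_left_cancel₀ hg.ne' h
  · intro x _
    simpa using ((hasDerivAt_id x).const_mul p.gSR).hasDerivWithinAt
  · rw [RelayParams.pdfSR, abs_of_pos hg]
    field_simp

theorem IsRelayChannel.map_linkSNR_RU (hch : IsRelayChannel p P hSR hRU) :
    P.map (linkSNR p.gRU hRU) = densityLaw p.pdfRU := by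
  have hg := p.gRU_pos
  have : linkSNR p.gRU hRU = (fun x => p.gRU * x ^ 2) ∘ fun ω => ‖hRU ω‖ := rfl
  have hm := hch.measurable_RU
  rw [this, ← Measure.map_map (by fun_prop) (by fun_prop), hch.law_RU]
  refine densityLaw_map (φ' := fun x => p.gRU * (2 * x)) (by fun_prop) ?_ ?_ ?_ fun x hx => ?_
  · ext y
    constructor
    · rintro ⟨x, hx, rfl⟩
      have : 0 < x := hx
      exact mul_pos hg (by positivity)
    · intro (hy : 0 < y)
      refine ⟨√(y / p.gRU), Real.sqrt_pos.2 (by positivity), ?_⟩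
      simp only [Real.sq_sqrt (div_pos hy hg).le]
      field_simp
  · intro x (hx : 0 < x) y (hy : 0 < y) h
    exact (pow_left_inj₀ hx.le hy.le two_ne_zero).1 (mul_left_cancel₀ hg.ne' h)
  · intro x _
    simpa using ((hasDerivAt_pow 2 x).const_mul p.gRU).hasDerivWithinAt
  · have hB := p.beta_m_ms_pos
    have hD : 0 < p.ms * p.Ωm := mul_pos p.ms_pos p.Ωm_pos
    have hE : 0 < p.m * p.Ωs := mul_pos p.m_pos p.Ωs_pos
    have h1 : 0 < p.m * p.Ωs * x ^ 2 + p.ms * p.Ωm := by positivity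
    have e : p.m * p.Ωs * (p.gRU * x ^ 2) + p.ms * p.Ωm * p.gRU =
      p.gRU * (p.m * p.Ωs * x ^ 2 + p.ms * p.Ωm) := by ring
    have e2 : (x ^ 2) ^ (p.m - 1) = x ^ (2 * p.m - 1) / x := by
      rw [← Real.rpow_natCast, ← Real.rpow_mul hx.le, ← Real.rpow_sub_one hx.ne']
      congr 1; push_cast; ring
    rw [RelayParams.pdfRU, RelayParams.pdfAmplitudeRU, e,
      abs_of_pos (by positivity), Real.mul_rpow hg.le h1.le, Real.mul_rpow hD.le hg.le,
      Real.mul_rpow hg.le (by positivity), e2, Real.rpow_add hg, Real.rpow_sub_one hg.ne']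
    have := Real.rpow_pos_of_pos hg p.m
    have := Real.rpow_pos_of_pos hg p.ms
    have := Real.rpow_pos_of_pos h1 (p.m + p.ms)
    field_simp

lemma distFun_eq_map {X : Ω → ℝ} (hX : Measurable X) (x : ℝ) :
    distFun P X x = (P.map X).real (Set.Iic x) := by
  rw [map_measureReal_apply hX measurableSet_Iic]
  rfl

theorem IsRelayChannel.distFun_SR (hch : IsRelayChannel p P hSR hRU) {x : ℝ} (hx : 0 < x) :
    distFun P (linkSNR p.gSR hSR) x = ∑ k ∈ Finset.range p.Γs,
      p.wSR k * (Real.Gamma (k + 1) - upperGam (k + 1) (p.rSR * x)) := by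
  rw [distFun_eq_map (measurable_linkSNR hch.measurable_SR _), hch.map_linkSNR_SR,
    densityLaw_real_Iic p.measurable_pdfSR p.pdfSR_nonneg, p.integral_Ioc_pdfSR hx]

theorem IsRelayChannel.distFun_RU (hch : IsRelayChannel p P hSR hRU) {x : ℝ} (hx : 0 < x) :
    distFun P (linkSNR p.gRU hRU) x =
      1 / beta p.m p.ms * lowerBeta p.m (p.m + p.ms) (p.A * x) := by
  rw [distFun_eq_map (measurable_linkSNR hch.measurable_RU _), hch.map_linkSNR_RU,
    densityLaw_real_Iic p.measurable_pdfRU p.pdfRU_nonneg, p.integral_Ioc_pdfRU hx]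

end Laws

/-! ### Expectations and distribution functions -/

lemma integrableOn_one_add_rpow {β a : ℝ} (hβ : 0 < β) (ha : -1 < a) :
    IntegrableOn (fun x : ℝ => (1 + x) ^ (-(β + 1))) (Set.Ioi a) := by
  have := integrableOn_add_rpow_Ioi_of_lt (a := -(β + 1)) (c := a) (m := 1) (by linarith) ha
  simpa only [add_comm] using this

lemma integral_Ioi_one_add_rpow {β a : ℝ} (hβ : 0 < β) (ha : 0 ≤ a) :
    ∫ x in Set.Ioi a, (1 + x) ^ (-(β + 1)) = (1 + a) ^ (-β) / β := by
  have hd : ∀ x ∈ Set.Ici a,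
      HasDerivAt (fun x : ℝ => -(1 + x) ^ (-β) / β) ((1 + x) ^ (-(β + 1))) x := by
    intro x hx
    have hx1 : 0 < 1 + x := by linarith [Set.mem_Ici.1 hx]
    have := ((((hasDerivAt_id x).const_add 1).rpow_const (p := -β) (Or.inl hx1.ne')).neg).div_const β
    refine this.congr_deriv ?_
    simp only [id, neg_add]
    rw [← sub_eq_add_neg]
    field_simp
  have ht : Filter.Tendsto (fun x : ℝ => -(1 + x) ^ (-β) / β) Filter.atTop (nhds (-0 / β)) :=
    (((tendsto_rpow_neg_atTop hβ).comp
      (Filter.tendsto_atTop_add_const_left _ 1 Filter.tendsto_id)).neg).div_const β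
  rw [integral_Ioi_of_hasDerivAt_of_tendsto' hd (integrableOn_one_add_rpow hβ (by linarith)) ht]
  ring

section

variable {Ω : Type*} [MeasurableSpace Ω] {P : Measure Ω} [IsProbabilityMeasure P]

/-- Write `(1 + X) ^ (-β)` as `β` times the integral of `(1 + x) ^ (-(β + 1))` over `x ≥ X`, and
exchange it with the expectation. -/
lemma integral_one_add_rpow_eq {X : Ω → ℝ} (hX : Measurable X) (h0 : ∀ ω, 0 ≤ X ω) {β : ℝ}
    (hβ : 0 < β) : ∫ ω, (1 + X ω) ^ (-β) ∂P =
      β * ∫ x in Set.Ioi (0 : ℝ), distFun P X x / (1 + x) ^ (β + 1) := by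
  have hS : MeasurableSet {q : Ω × ℝ | X q.1 ≤ q.2} :=
    measurableSet_le (hX.comp measurable_fst) measurable_snd
  have hI : Integrable (Set.indicator {q : Ω × ℝ | X q.1 ≤ q.2}
      fun q => (1 : ℝ) * (1 + q.2) ^ (-(β + 1))) (P.prod (volume.restrict (Set.Ioi 0))) :=
    ((integrable_const (1 : ℝ)).mul_prod
      (integrableOn_one_add_rpow hβ (by norm_num : (-1 : ℝ) < 0))).indicator hS
  have hsw := integral_integral_swap (f := fun ω x => Set.indicator {q : Ω × ℝ | X q.1 ≤ q.2}
      (fun q => (1 : ℝ) * (1 + q.2) ^ (-(β + 1))) (ω, x)) hI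
  have e1 : ∀ ω, ∫ x in Set.Ioi (0 : ℝ), Set.indicator {q : Ω × ℝ | X q.1 ≤ q.2}
      (fun q => (1 : ℝ) * (1 + q.2) ^ (-(β + 1))) (ω, x) = (1 + X ω) ^ (-β) / β := by
    intro ω
    have : (fun x => Set.indicator {q : Ω × ℝ | X q.1 ≤ q.2}
        (fun q => (1 : ℝ) * (1 + q.2) ^ (-(β + 1))) (ω, x)) =
        Set.indicator (Set.Ici (X ω)) fun x => (1 + x) ^ (-(β + 1)) := by
      ext x
      simp only [Set.indicator, Set.mem_ofPred_eq, Set.mem_Ici, one_mul]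
    rw [this, ← integral_Ioi_one_add_rpow hβ (h0 ω), setIntegral_indicator measurableSet_Ici,
      ← integral_Ici_eq_integral_Ioi]
    refine setIntegral_congr_set ?_
    by_cases h : 0 < X ω
    · have hsub : Set.Ici (X ω) ⊆ Set.Ioi 0 := Set.Ici_subset_Ioi.2 h
      rw [Set.inter_eq_right.2 hsub]
      exact Filter.EventuallyEq.rfl
    · have h' : X ω = 0 := le_antisymm (not_lt.1 h) (h0 ω)
      rw [h', Set.inter_eq_left.2 Set.Ioi_subset_Ici_self]
      exact Ioi_ae_eq_Ici
  have e2 : ∀ x, ∫ ω, Set.indicator {q : Ω × ℝ | X q.1 ≤ q.2}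
      (fun q => (1 : ℝ) * (1 + q.2) ^ (-(β + 1))) (ω, x) ∂P =
      distFun P X x * (1 + x) ^ (-(β + 1)) := by
    intro x
    have hm : MeasurableSet {ω | X ω ≤ x} := measurableSet_le hX measurable_const
    have : (fun ω => Set.indicator {q : Ω × ℝ | X q.1 ≤ q.2}
        (fun q => (1 : ℝ) * (1 + q.2) ^ (-(β + 1))) (ω, x)) =
        Set.indicator {ω | X ω ≤ x} fun _ => (1 + x) ^ (-(β + 1)) := by
      ext ω
      simp only [Set.indicator, Set.mem_ofPred_eq, one_mul]
    rw [this, integral_indicator_const _ hm, smul_eq_mul, distFun]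
  simp only [e1, e2, integral_div] at hsw
  rw [div_eq_iff hβ.ne'] at hsw
  rw [hsw, mul_comm]
  congr 1
  refine setIntegral_congr_fun measurableSet_Ioi fun x (hx : 0 < x) => ?_
  simp only [Real.rpow_neg (show 0 ≤ 1 + x by linarith), div_eq_mul_inv]

lemma integral_indepFun {X Y : Ω → ℝ} (hX : Measurable X) (hY : Measurable Y)
    (h : IndepFun X Y P) {G : ℝ × ℝ → ℝ} (hG : Measurable G) (hb : ∀ z, ‖G z‖ ≤ 1) :
    Integrable (fun u => ∫ ω, G (u, Y ω) ∂P) (P.map X) ∧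
      ∫ ω, G (X ω, Y ω) ∂P = ∫ u, ∫ ω, G (u, Y ω) ∂P ∂(P.map X) := by
  have := Measure.isProbabilityMeasure_map (μ := P) hX.aemeasurable
  have := Measure.isProbabilityMeasure_map (μ := P) hY.aemeasurable
  have hI : Integrable G ((P.map X).prod (P.map Y)) :=
    Integrable.of_bound hG.aestronglyMeasurable 1 (.of_forall hb)
  have e : ∀ u, ∫ ω, G (u, Y ω) ∂P = ∫ v, G (u, v) ∂(P.map Y) := fun u =>
    (integral_map hY.aemeasurable (hG.comp measurable_prodMk_left).aestronglyMeasurable).symm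
  simp only [e]
  refine ⟨hI.integral_prod_left, ?_⟩
  rw [← integral_prod _ hI, ← h.map_prod_eq_prod_map_map hX.aemeasurable hY.aemeasurable,
    integral_map (hX.prodMk hY).aemeasurable hG.aestronglyMeasurable]

lemma one_add_abs_rpow_le_one {β : ℝ} (hβ : 0 < β) (u : ℝ) : (1 + |u|) ^ (-β) ≤ 1 :=
  Real.rpow_le_one_of_one_le_of_nonpos (by linarith [abs_nonneg u]) (by linarith)

/-- The contribution of the event `Y ≤ X` to the expectation of `(1 + X) ^ (-β)`. -/
lemma integral_indicator_le {X Y : Ω → ℝ} (hX : Measurable X) (hY : Measurable Y)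
    (h : IndepFun X Y P) (hX0 : ∀ ω, 0 ≤ X ω) {β : ℝ} (hβ : 0 < β) {f : ℝ → ℝ}
    (hf : Measurable f) (hf0 : ∀ x, 0 < x → 0 ≤ f x) (hlaw : P.map X = densityLaw f) :
    IntegrableOn (fun x => f x * distFun P Y x / (1 + x) ^ β) (Set.Ioi 0) ∧
      ∫ ω, Set.indicator {ω | Y ω ≤ X ω} (fun ω => (1 + X ω) ^ (-β)) ω ∂P =
        ∫ x in Set.Ioi (0 : ℝ), f x * distFun P Y x / (1 + x) ^ β := by
  -- The absolute value makes `G` bounded by 1 on the whole plane and changes nothing where `X ≥ 0`.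
  set G : ℝ × ℝ → ℝ := Set.indicator {z | z.2 ≤ z.1} fun z => (1 + |z.1|) ^ (-β) with hGdef
  have hG : Measurable G :=
    Measurable.indicator (by fun_prop) (measurableSet_le measurable_snd measurable_fst)
  have hb : ∀ z, ‖G z‖ ≤ 1 := by
    intro z
    refine (norm_indicator_le_norm_self _ _).trans ?_
    rw [Real.norm_of_nonneg (by positivity)]
    exact one_add_abs_rpow_le_one hβ _
  obtain ⟨h1, h2⟩ := integral_indepFun hX hY h hG hb
  have e : ∀ u, ∫ ω, G (u, Y ω) ∂P = distFun P Y u * (1 + |u|) ^ (-β) := by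
    intro u
    have hm : MeasurableSet {ω | Y ω ≤ u} := measurableSet_le hY measurable_const
    have : (fun ω => G (u, Y ω)) = Set.indicator {ω | Y ω ≤ u} fun _ => (1 + |u|) ^ (-β) := by
      ext ω
      simp only [hGdef, Set.indicator, Set.mem_ofPred_eq]
    rw [this, integral_indicator_const _ hm, smul_eq_mul, distFun]
  have e3 : ∀ x ∈ Set.Ioi (0 : ℝ), f x * (distFun P Y x * (1 + |x|) ^ (-β)) =
      f x * distFun P Y x / (1 + x) ^ β := fun x (hx : 0 < x) => by
    rw [abs_of_pos hx, Real.rpow_neg (by linarith)]; ring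
  simp only [e, hlaw] at h1 h2
  rw [integrable_densityLaw_iff hf hf0] at h1
  rw [integral_densityLaw hf hf0, setIntegral_congr_fun measurableSet_Ioi e3] at h2
  refine ⟨h1.congr_fun e3 measurableSet_Ioi, ?_⟩
  rw [← h2]
  refine integral_congr_ae (.of_forall fun ω => ?_)
  simp only [hGdef, Set.indicator, Set.mem_ofPred_eq, abs_of_nonneg (hX0 ω)]

lemma integral_one_add_rpow_of_law {X : Ω → ℝ} (hX : Measurable X) {β : ℝ} (hβ : 0 < β)
    {f : ℝ → ℝ} (hf : Measurable f) (hf0 : ∀ x, 0 < x → 0 ≤ f x)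
    (hlaw : P.map X = densityLaw f) :
    IntegrableOn (fun x => f x / (1 + x) ^ β) (Set.Ioi 0) ∧
      ∫ ω, (1 + X ω) ^ (-β) ∂P = ∫ x in Set.Ioi (0 : ℝ), f x / (1 + x) ^ β := by
  have := Measure.isProbabilityMeasure_map (μ := P) hX.aemeasurable
  have e3 : ∀ x ∈ Set.Ioi (0 : ℝ), f x * (1 + x) ^ (-β) = f x / (1 + x) ^ β :=
    fun x (hx : 0 < x) => by rw [Real.rpow_neg (by linarith)]; rfl
  have hm : Measurable fun x : ℝ => (1 + x) ^ (-β) := by fun_prop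
  have hI : Integrable (fun x => (1 + x) ^ (-β)) (densityLaw f) := by
    rw [hlaw] at this
    refine Integrable.of_bound (C := 1) hm.aestronglyMeasurable ?_
    filter_upwards [ae_pos_densityLaw f] with x hx
    rw [Real.norm_of_nonneg (by positivity)]
    simpa [abs_of_pos hx] using one_add_abs_rpow_le_one hβ x
  rw [integrable_densityLaw_iff hf hf0] at hI
  refine ⟨hI.congr_fun e3 measurableSet_Ioi, ?_⟩
  rw [← setIntegral_congr_fun measurableSet_Ioi e3, ← integral_densityLaw hf hf0, ← hlaw,
    integral_map hX.aemeasurable hm.aestronglyMeasurable]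

/-- Under the product law each slice of the diagonal is a single point, which is null for a law with
a density. -/
lemma ae_ne_of_indepFun {X Y : Ω → ℝ} (hX : Measurable X) (hY : Measurable Y)
    (h : IndepFun X Y P) {f : ℝ → ℝ} (hlaw : P.map Y = densityLaw f) :
    ∀ᵐ ω ∂P, X ω ≠ Y ω := by
  have hm : MeasurableSet {z : ℝ × ℝ | z.1 = z.2} :=
    measurableSet_eq_fun measurable_fst measurable_snd
  have := Measure.isProbabilityMeasure_map (μ := P) hY.aemeasurable
  have h0 : ((P.map X).prod (P.map Y)) {z : ℝ × ℝ | z.1 = z.2} = 0 := by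
    rw [Measure.measure_prod_null hm]
    refine .of_forall fun u => ?_
    have : Prod.mk u ⁻¹' {z : ℝ × ℝ | z.1 = z.2} = {u} := by
      ext v; simp [eq_comm]
    change P.map Y (Prod.mk u ⁻¹' {z : ℝ × ℝ | z.1 = z.2}) = 0
    rw [this, hlaw]
    refine withDensity_absolutelyContinuous _ _ ?_
    exact Measure.absolutelyContinuous_of_le Measure.restrict_le_self (measure_singleton u)
  rw [← h.map_prod_eq_prod_map_map hX.aemeasurable hY.aemeasurable,
    Measure.map_apply (hX.prodMk hY) hm] at h0
  exact measure_eq_zero_iff_ae_notMem.1 h0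

lemma integrable_one_add_rpow {X : Ω → ℝ} (hX : Measurable X) (h0 : ∀ ω, 0 ≤ X ω) {β : ℝ}
    (hβ : 0 < β) : Integrable (fun ω => (1 + X ω) ^ (-β)) P := by
  have hm : Measurable fun ω => (1 + X ω) ^ (-β) := by fun_prop
  refine Integrable.of_bound (C := 1) hm.aestronglyMeasurable (.of_forall fun ω => ?_)
  rw [Real.norm_of_nonneg (Real.rpow_nonneg (by linarith [h0 ω]) _)]
  simpa [abs_of_nonneg (h0 ω)] using one_add_abs_rpow_le_one hβ (X ω)

/-- From the sum of the two terms the one belonging to the larger variable is removed. On a tie both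
would be removed, hence the need for `ae_ne_of_indepFun`. -/
theorem integral_one_add_min_rpow {X Y : Ω → ℝ} (hX : Measurable X) (hY : Measurable Y)
    (h : IndepFun X Y P) (hX0 : ∀ ω, 0 ≤ X ω) (hY0 : ∀ ω, 0 ≤ Y ω) {β : ℝ} (hβ : 0 < β)
    {f : ℝ → ℝ} (hlaw : P.map Y = densityLaw f) :
    ∫ ω, (1 + min (X ω) (Y ω)) ^ (-β) ∂P =
      ∫ ω, (1 + X ω) ^ (-β) ∂P + ∫ ω, (1 + Y ω) ^ (-β) ∂P -
        ∫ ω, Set.indicator {ω | Y ω ≤ X ω} (fun ω => (1 + X ω) ^ (-β)) ω ∂P -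
        ∫ ω, Set.indicator {ω | X ω ≤ Y ω} (fun ω => (1 + Y ω) ^ (-β)) ω ∂P := by
  have i1 := integrable_one_add_rpow (P := P) hX hX0 hβ
  have i2 := integrable_one_add_rpow (P := P) hY hY0 hβ
  have i3 := i1.indicator (measurableSet_le hY hX)
  have i4 := i2.indicator (measurableSet_le hX hY)
  have i12 : Integrable (fun ω => (1 + X ω) ^ (-β) + (1 + Y ω) ^ (-β)) P := i1.add i2
  have i123 : Integrable (fun ω => (1 + X ω) ^ (-β) + (1 + Y ω) ^ (-β) -
      Set.indicator {ω | Y ω ≤ X ω} (fun ω => (1 + X ω) ^ (-β)) ω) P := i12.sub i3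
  rw [← integral_add i1 i2, ← integral_sub i12 i3, ← integral_sub i123 i4]
  refine integral_congr_ae ?_
  filter_upwards [ae_ne_of_indepFun hX hY h hlaw] with ω hω
  simp only [Set.indicator, Set.mem_ofPred_eq]
  rcases lt_or_gt_of_ne hω with hlt | hlt
  · rw [min_eq_left hlt.le, if_neg (not_le.2 hlt), if_pos hlt.le]; ring
  · rw [min_eq_right hlt.le, if_pos hlt.le, if_neg (not_le.2 hlt)]; ring

/-- Distribution function of `X Y / (Y + C)` for independent nonnegative `X` and `Y`. -/
theorem distFun_mul_div_add {X Y : Ω → ℝ} (hX : Measurable X) (hY : Measurable Y)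
    (h : IndepFun X Y P) (hY0 : ∀ ω, 0 ≤ Y ω) {C : ℝ} (hC : 0 < C)
    {f : ℝ → ℝ} (hf : Measurable f) (hf0 : ∀ x, 0 < x → 0 ≤ f x)
    (hlaw : P.map X = densityLaw f) {x : ℝ} (hx : 0 < x) :
    IntegrableOn (fun y => distFun P Y (C * x / y) * f (y + x)) (Set.Ioi 0) ∧
      distFun P (fun ω => X ω * Y ω / (Y ω + C)) x = distFun P X x +
        ∫ y in Set.Ioi (0 : ℝ), distFun P Y (C * x / y) * f (y + x) := by
  set S : Set (ℝ × ℝ) := {z | z.1 * z.2 / (z.2 + C) ≤ x} with hSdef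
  have hS : MeasurableSet S := measurableSet_le (by fun_prop) measurable_const
  have hG : Measurable (S.indicator fun _ => (1 : ℝ)) := measurable_const.indicator hS
  obtain ⟨h1, h2⟩ := integral_indepFun hX hY h hG fun z =>
    (norm_indicator_le_norm_self _ _).trans (by simp)
  have e : ∀ u, ∫ ω, S.indicator (fun _ => (1 : ℝ)) (u, Y ω) ∂P =
      P.real {ω | u * Y ω / (Y ω + C) ≤ x} := by
    intro u
    have hm : MeasurableSet {ω | u * Y ω / (Y ω + C) ≤ x} :=
      measurableSet_le (by fun_prop) measurable_const
    have : (fun ω => S.indicator (fun _ => (1 : ℝ)) (u, Y ω)) =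
        Set.indicator {ω | u * Y ω / (Y ω + C) ≤ x} fun _ => (1 : ℝ) := by
      ext ω
      simp only [hSdef, Set.indicator, Set.mem_ofPred_eq]
    rw [this, integral_indicator_const _ hm, smul_eq_mul, mul_one]
  have e0 : ∫ ω, S.indicator (fun _ => (1 : ℝ)) (X ω, Y ω) ∂P =
      distFun P (fun ω => X ω * Y ω / (Y ω + C)) x := by
    have hm : MeasurableSet {ω | X ω * Y ω / (Y ω + C) ≤ x} :=
      measurableSet_le (by fun_prop) measurable_const
    have : (fun ω => S.indicator (fun _ => (1 : ℝ)) (X ω, Y ω)) =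
        Set.indicator {ω | X ω * Y ω / (Y ω + C) ≤ x} fun _ => (1 : ℝ) := by
      ext ω
      simp only [hSdef, Set.indicator, Set.mem_ofPred_eq]
    rw [this, integral_indicator_const _ hm, smul_eq_mul, mul_one, distFun]
  simp only [e, e0, hlaw] at h1 h2
  rw [integrable_densityLaw_iff hf hf0] at h1
  rw [integral_densityLaw hf hf0] at h2
  -- Since `Y / (Y + C) ≤ 1`, the event is certain for `u ≤ x`; this part gives the distribution
  -- function of `X`.
  have c1 : ∀ u ∈ Set.Ioc 0 x, f u * P.real {ω | u * Y ω / (Y ω + C) ≤ x} = f u := by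
    intro u hu
    have : {ω | u * Y ω / (Y ω + C) ≤ x} = Set.univ := by
      ext ω
      have hy := hY0 ω
      have : u * Y ω ≤ x * (Y ω + C) := by
        nlinarith [mul_le_mul_of_nonneg_right hu.2 hy, mul_pos hx hC]
      simpa using (div_le_iff₀ (by linarith)).2 this
    rw [this, probReal_univ, mul_one]
  -- For `u > x` the inequality is solved for `Y`; the translation `u = y + x` then yields the
  -- second term.
  have c2 : ∀ u ∈ Set.Ioi x, f u * P.real {ω | u * Y ω / (Y ω + C) ≤ x} =
      distFun P Y (C * x / (u - x)) * f (u - x + x) := by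
    intro u (hu : x < u)
    have hset : {ω | u * Y ω / (Y ω + C) ≤ x} = {ω | Y ω ≤ C * x / (u - x)} := by
      ext ω
      have hy := hY0 ω
      change u * Y ω / (Y ω + C) ≤ x ↔ Y ω ≤ C * x / (u - x)
      rw [div_le_iff₀ (by linarith), le_div_iff₀ (by linarith)]
      constructor <;> intro h <;> linarith
    rw [mul_comm, sub_add_cancel, distFun, hset]
  have hpre : (fun y : ℝ => y + x) ⁻¹' Set.Ioi x = Set.Ioi 0 := by ext y; simp
  have hmp := measurePreserving_add_right (volume : Measure ℝ) x
  have hemb : MeasurableEmbedding fun y : ℝ => y + x := measurableEmbedding_addRight x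
  have h3 := (h1.mono_set (Set.Ioi_subset_Ioi hx.le)).congr_fun c2 measurableSet_Ioi
  have h4 := (hmp.integrableOn_comp_preimage hemb).2 h3
  have h5 := hmp.setIntegral_preimage_emb hemb
    (fun u => distFun P Y (C * x / (u - x)) * f (u - x + x)) (Set.Ioi x)
  rw [hpre] at h4 h5
  simp only [Function.comp_def, add_sub_cancel_right] at h4 h5
  refine ⟨h4, ?_⟩
  rw [h2, ← Set.Ioc_union_Ioi_eq_Ioi hx.le, setIntegral_union (Set.Ioc_disjoint_Ioi le_rfl)
    measurableSet_Ioi (h1.mono_set Set.Ioc_subset_Ioi_self)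
    (h1.mono_set (Set.Ioi_subset_Ioi hx.le)), setIntegral_congr_fun measurableSet_Ioc c1,
    setIntegral_congr_fun measurableSet_Ioi c2, ← h5, distFun_eq_map hX, hlaw,
    densityLaw_real_Iic hf hf0, Set.Ioc_union_Ioi_eq_Ioi hx.le]

end

lemma effectiveCapacity_eq {Ω : Type*} [MeasurableSpace Ω] (P : Measure Ω) (p : RelayParams)
    {γ : Ω → ℝ} (h0 : ∀ ω, 0 ≤ γ ω) :
    effectiveCapacity p P γ = -(1 / p.θ) * Real.log (∫ ω, (1 + γ ω) ^ (-p.β) ∂P) := by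
  rw [effectiveCapacity]
  congr 3
  ext ω
  have h1 : 0 < 1 + γ ω := by linarith [h0 ω]
  rw [Real.rpow_def_of_pos h1, RelayParams.β, Real.logb]
  congr 1
  ring

/-! ### Evaluation of the closed forms -/

lemma integrableOn_mul_gamKer_nat_Ioi {k : ℕ} {r : ℝ} {H : ℝ → ℝ}
    (hr : 0 < r) (h : IntegrableOn (fun y => gamKer k y * H y) (Set.Ioi 0)) :
    IntegrableOn (fun y => gamKer k (r * y) * H (r * y)) (Set.Ioi 0) := by
  have := integrableOn_Ioi_comp_mul_left_iff (fun y => gamKer k y * H y) 0 hr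
  rw [mul_zero] at this
  exact this.2 h

/-- The binomial theorem separates the two arguments; this is the origin of the sum over `i` in
`closedM2`. -/
lemma gamKer_nat_add (k : ℕ) (u v : ℝ) : gamKer k (u + v) =
    ∑ i ∈ Finset.range (k + 1), (k.choose i : ℝ) * (gamKer i u * gamKer ((k : ℝ) - i) v) := by
  rw [gamKer, Real.rpow_natCast, add_pow, neg_add, Real.exp_add, Finset.sum_mul]
  refine Finset.sum_congr rfl fun i hi => ?_
  have hi' : i ≤ k := Nat.lt_succ_iff.1 (Finset.mem_range.1 hi)
  rw [gamKer, gamKer, ← Nat.cast_sub hi', Real.rpow_natCast, Real.rpow_natCast]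
  ring

/-- Under `x = t / (1 - t)` the factor `1 + A * x` becomes `(1 - (1 - A) * t) / (1 - t)`, which
explains the argument `1 - A`. -/
theorem hyp2F1_eq_integral {a b c A : ℝ} (hA : 0 < A) (hb : 0 < b) (hc : b < c) :
    beta b (c - b) * hyp2F1 a b c (1 - A) =
      ∫ x in Set.Ioi (0 : ℝ), betaKer (b - 1) (c - a) x * betaKer 0 a (A * x) := by
  rw [hyp2F1, one_div, mul_inv_cancel_left₀ (beta_pos hb (sub_pos.2 hc)).ne',
    integral_Ioi_eq_integral_Ioo, intervalIntegral.integral_of_le zero_le_one,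
    integral_Ioc_eq_integral_Ioo]
  refine setIntegral_congr_fun measurableSet_Ioo fun t ht => ?_
  have h0 : 0 < t := ht.1
  have h1 : 0 < 1 - t := sub_pos.2 ht.2
  have h2 : 0 < 1 - (1 - A) * t := by nlinarith
  have e1 : 1 + t / (1 - t) = (1 - t)⁻¹ := by field_simp; ring
  have e3 : 1 + A * (t / (1 - t)) = (1 - (1 - A) * t) / (1 - t) := by field_simp; ring
  have e2 : ((1 - t) ^ 2)⁻¹ = Real.exp (Real.log (1 - t) * (-2)) := by
    rw [← Real.rpow_def_of_pos h1, Real.rpow_neg h1.le]; norm_cast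
  simp only [betaKer, smul_eq_mul]
  rw [e1, e2, e3, Real.rpow_zero, one_mul, Real.rpow_def_of_pos h0, Real.rpow_def_of_pos h1,
    Real.rpow_def_of_pos h2, Real.rpow_def_of_pos (div_pos h0 h1),
    Real.rpow_def_of_pos (inv_pos.2 h1), Real.rpow_def_of_pos (div_pos h2 h1), Real.log_inv,
    Real.log_div h0.ne' h1.ne', Real.log_div h2.ne' h1.ne']
  simp only [← Real.exp_add]
  congr 1
  ring

lemma betaKer_mul_gamKer_nat {r x : ℝ} (hx : 0 < x) (k : ℕ) (β : ℝ) :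
    r * gamKer k (r * x) / (1 + x) ^ β =
      r ^ (k + 1) * (betaKer k β x * gamKer 0 (r * x)) := by
  rw [gamKer, gamKer, betaKer, Real.rpow_natCast, Real.rpow_natCast, Real.rpow_zero,
    Real.rpow_neg (by linarith)]
  ring

namespace RelayParams

variable (p : RelayParams)

theorem integral_pdfSR_div :
    ((∫ x in Set.Ioi (0 : ℝ), p.pdfSR x / (1 + x) ^ p.β : ℝ) : ℂ) = p.closedSR := by
  have hG := fun k : ℕ => (meijerG_gamma_kernel k p.β_pos p.rSR_pos).2
  have e : ∫ x in Set.Ioi (0 : ℝ), p.pdfSR x / (1 + x) ^ p.β = ∑ k ∈ Finset.range p.Γs,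
      (p.wSR k * p.rSR ^ (k + 1)) *
        ∫ t in Set.Ioi (0 : ℝ), betaKer k p.β t * gamKer 0 (p.rSR * t) := by
    simp only [← integral_const_mul]
    rw [← integral_finsetSum _ fun k _ => (hG k).2.const_mul _]
    refine setIntegral_congr_fun measurableSet_Ioi fun x hx => ?_
    simp only [pdfSR_eq, Finset.sum_div]
    refine Finset.sum_congr rfl fun k _ => ?_
    rw [mul_div_assoc, betaKer_mul_gamKer_nat hx, mul_assoc]
  rw [e, closedSR]
  simp only [(hG _).1, ← Complex.ofReal_mul, ← Complex.ofReal_sum]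
  congr 1
  rw [Finset.mul_sum]
  refine Finset.sum_congr rfl fun k _ => ?_
  have := Real.Gamma_pos_of_pos p.β_pos
  rw [← gSR_wSR]
  field_simp

theorem integral_pdfRU_div :
    ((∫ x in Set.Ioi (0 : ℝ), p.pdfRU x / (1 + x) ^ p.β : ℝ) : ℂ) = p.closedRU := by
  have hG := (meijerG_beta_kernel p.m_pos p.ms_pos p.β_pos p.A_pos).2
  have e : ∫ x in Set.Ioi (0 : ℝ), p.pdfRU x / (1 + x) ^ p.β = 1 / beta p.m p.ms *
        ∫ t in Set.Ioi (0 : ℝ), betaKer (-1) p.β t * betaKer p.m (p.m + p.ms) (p.A * t) := by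
    rw [← integral_const_mul]
    refine setIntegral_congr_fun measurableSet_Ioi fun x (hx : 0 < x) => ?_
    simp only [p.pdfRU_eq hx]
    have : betaKer (-1) p.β x = x⁻¹ * ((1 + x) ^ p.β)⁻¹ := by
      rw [betaKer, Real.rpow_neg_one, Real.rpow_neg (by linarith)]
    rw [this]
    ring
  rw [e, closedRU, hG.1, ← Complex.ofReal_mul]
  congr 1
  have h1 := Real.Gamma_pos_of_pos p.β_pos
  have h2 := Real.Gamma_pos_of_pos p.m_pos
  have h3 := Real.Gamma_pos_of_pos p.ms_pos
  have h4 := Real.Gamma_pos_of_pos (add_pos p.m_pos p.ms_pos)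
  rw [beta]
  field_simp

end RelayParams

/-! ### The integrals `M₁`, `M₂`, `N₁`, `N₂` of the relay channel -/

section Channel

variable {Ω : Type*} [MeasurableSpace Ω] {P : Measure Ω} {p : RelayParams} {hSR hRU : Ω → ℂ}

theorem IsRelayChannel.integral_M1 (hch : IsRelayChannel p P hSR hRU) :
    IntegrableOn (fun x => distFun P (linkSNR p.gSR hSR) x / (1 + x) ^ (p.β + 1)) (Set.Ioi 0) ∧
      ((∫ x in Set.Ioi (0 : ℝ), distFun P (linkSNR p.gSR hSR) x / (1 + x) ^ (p.β + 1) : ℝ) : ℂ) =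
        p.closedM1 := by
  have hG := fun k : ℕ => (meijerG_upperGam_kernel k p.β_pos p.rSR_pos).2
  have hI : IntegrableOn (fun x : ℝ => (1 + x) ^ (-(p.β + 1))) (Set.Ioi 0) :=
    integrableOn_one_add_rpow p.β_pos (by norm_num)
  have e : ∀ x ∈ Set.Ioi (0 : ℝ), ∑ k ∈ Finset.range p.Γs, p.wSR k *
      (Real.Gamma (k + 1) * (1 + x) ^ (-(p.β + 1)) -
        betaKer 0 (p.β + 1) x * upperGam (k + 1) (p.rSR * x)) =
      distFun P (linkSNR p.gSR hSR) x / (1 + x) ^ (p.β + 1) := fun x (hx : 0 < x) => by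
    rw [hch.distFun_SR hx, Finset.sum_div]
    refine Finset.sum_congr rfl fun k _ => ?_
    rw [betaKer, Real.rpow_zero, Real.rpow_neg (by linarith)]
    ring
  have hi : ∀ k : ℕ, IntegrableOn (fun x => Real.Gamma (k + 1) * (1 + x) ^ (-(p.β + 1)) -
        betaKer 0 (p.β + 1) x * upperGam (k + 1) (p.rSR * x)) (Set.Ioi 0) := fun k =>
    (hI.const_mul _).sub (hG k).2
  have hi' : ∀ k ∈ Finset.range p.Γs, IntegrableOn (fun x => p.wSR k *
      (Real.Gamma (k + 1) * (1 + x) ^ (-(p.β + 1)) -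
        betaKer 0 (p.β + 1) x * upperGam (k + 1) (p.rSR * x))) (Set.Ioi 0) := fun k _ =>
    (hi k).const_mul _
  refine ⟨IntegrableOn.congr_fun (integrable_finsetSum _ hi') e measurableSet_Ioi, ?_⟩
  rw [← setIntegral_congr_fun measurableSet_Ioi e, integral_finsetSum _ hi',
    RelayParams.closedM1]
  simp only [(hG _).1, ← Complex.ofReal_mul, ← Complex.ofReal_sum, ← Complex.ofReal_div,
    ← Complex.ofReal_sub]
  congr 1
  refine Finset.sum_congr rfl fun k _ => ?_
  have h1 := Real.Gamma_pos_of_pos (show 0 < p.β + 1 by linarith [p.β_pos])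
  rw [integral_const_mul, integral_sub (hI.const_mul _) (hG k).2, integral_const_mul,
    integral_Ioi_one_add_rpow p.β_pos le_rfl, RelayParams.wSR, mul_div_cancel_left₀ _ h1.ne']
  simp
  ring_nf
  simp

/-- After the binomial splitting, the substitution `y ↦ rSR * y` turns the inner integral into a
`gamAverage` of the incomplete Beta function at `rSR * A * C * x`. -/
theorem IsRelayChannel.termL_eq (hch : IsRelayChannel p P hSR hRU) {x : ℝ} (hx : 0 < x) :
    termL p P hRU x = ∑ k ∈ Finset.range p.Γs, ∑ i ∈ Finset.range (k + 1),
      p.wSR k * (1 / beta p.m p.ms) * k.choose i * (gamKer ((k : ℝ) - i) (p.rSR * x) *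
        gamAverage i (lowerBeta p.m (p.m + p.ms)) (p.rSR * p.A * p.C * x)) := by
  have hr := p.rSR_pos
  have hw : 0 < p.rSR * p.A * p.C * x := mul_pos (mul_pos (mul_pos hr p.A_pos) p.C_pos) hx
  -- Any line on which `lowerBeta` is represented will do here: it only yields integrability in `y`.
  obtain ⟨c, h4, h5⟩ := exists_between (show (0 : ℝ) < min p.m 1 from lt_min p.m_pos one_pos)
  rw [lt_min_iff] at h5
  have hrep := mellinRep_lowerBeta (b := p.m + p.ms) h5.1 (by linarith [p.ms_pos]) h4
  set H := lowerBeta p.m (p.m + p.ms) with hH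
  have hi : ∀ i : ℕ, IntegrableOn (fun y => gamKer i (p.rSR * y) *
      H (p.rSR * p.A * p.C * x * (p.rSR * y)⁻¹)) (Set.Ioi 0) := fun i =>
    integrableOn_mul_gamKer_nat_Ioi (H := fun y => H (p.rSR * p.A * p.C * x * y⁻¹)) hr
      (hrep.integrableOn_gamAverage (by linarith [i.cast_nonneg (α := ℝ)]) hw)
  have hint : ∀ i : ℕ, gamAverage i H (p.rSR * p.A * p.C * x) = p.rSR *
      ∫ y in Set.Ioi (0 : ℝ), gamKer i (p.rSR * y) *
        H (p.rSR * p.A * p.C * x * (p.rSR * y)⁻¹) := fun i => by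
    have := integral_comp_mul_left_Ioi'
      (fun y => gamKer i y * H (p.rSR * p.A * p.C * x * y⁻¹)) 0 hr
    rw [mul_zero, smul_eq_mul] at this
    rw [this, gamAverage]
  have e : ∀ y ∈ Set.Ioi (0 : ℝ),
      distFun P (linkSNR p.gRU hRU) (p.C * x / y) * p.pdfSR (y + x) =
      ∑ k ∈ Finset.range p.Γs, ∑ i ∈ Finset.range (k + 1),
        p.wSR k * (1 / beta p.m p.ms) * k.choose i * (gamKer ((k : ℝ) - i) (p.rSR * x) * p.rSR) *
          (gamKer i (p.rSR * y) * H (p.rSR * p.A * p.C * x * (p.rSR * y)⁻¹)) := by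
    intro y (hy : 0 < y)
    have ha : p.rSR * p.A * p.C * x * (p.rSR * y)⁻¹ = p.A * (p.C * x / y) := by field_simp
    rw [hch.distFun_RU (div_pos (mul_pos p.C_pos hx) hy), p.pdfSR_eq, ha, ← hH, Finset.mul_sum]
    refine Finset.sum_congr rfl fun k _ => ?_
    rw [mul_add, gamKer_nat_add, Finset.mul_sum, Finset.mul_sum, Finset.mul_sum]
    refine Finset.sum_congr rfl fun i _ => ?_
    ring
  rw [termL, setIntegral_congr_fun measurableSet_Ioi e, integral_finsetSum]
  · refine Finset.sum_congr rfl fun k _ => ?_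
    rw [integral_finsetSum _ fun i _ => (hi i).const_mul _]
    refine Finset.sum_congr rfl fun i _ => ?_
    rw [integral_const_mul, hint]
    ring
  · exact fun k _ => integrable_finsetSum _ fun i _ => (hi i).const_mul _

theorem IsRelayChannel.integral_M2 (hch : IsRelayChannel p P hSR hRU) :
    IntegrableOn (fun x => termL p P hRU x / (1 + x) ^ (p.β + 1)) (Set.Ioi 0) ∧
      ((∫ x in Set.Ioi (0 : ℝ), termL p P hRU x / (1 + x) ^ (p.β + 1) : ℝ) : ℂ) =
        p.closedM2 := by
  have hw : 0 < p.rSR * p.A * p.C := mul_pos (mul_pos p.rSR_pos p.A_pos) p.C_pos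
  have hG := fun k i (hik : i ∈ Finset.range (k + 1)) =>
    (p.meijerG2_M2 k i (Nat.lt_succ_iff.1 (Finset.mem_range.1 hik)) p.rSR_pos hw).2
  have e : ∀ x ∈ Set.Ioi (0 : ℝ), ∑ k ∈ Finset.range p.Γs, ∑ i ∈ Finset.range (k + 1),
      p.wSR k * (1 / beta p.m p.ms) * k.choose i *
        (betaKer 0 (p.β + 1) x * (gamKer ((k : ℝ) - i) (p.rSR * x) *
        gamAverage i (lowerBeta p.m (p.m + p.ms)) (p.rSR * p.A * p.C * x))) =
      termL p P hRU x / (1 + x) ^ (p.β + 1) := fun x (hx : 0 < x) => by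
    rw [hch.termL_eq hx, Finset.sum_div]
    refine Finset.sum_congr rfl fun k _ => ?_
    rw [Finset.sum_div]
    refine Finset.sum_congr rfl fun i _ => ?_
    rw [betaKer, Real.rpow_zero, Real.rpow_neg (by linarith)]
    ring
  refine ⟨IntegrableOn.congr_fun (integrable_finsetSum _ fun k _ => integrable_finsetSum _
    fun i hi => (hG k i hi).2.const_mul _) e measurableSet_Ioi, ?_⟩
  rw [← setIntegral_congr_fun measurableSet_Ioi e, integral_finsetSum _ fun k _ =>
    integrable_finsetSum _ fun i hi => (hG k i hi).2.const_mul _, RelayParams.closedM2,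
    Complex.ofReal_sum]
  refine Finset.sum_congr rfl fun k _ => ?_
  rw [integral_finsetSum _ fun i hi => (hG k i hi).2.const_mul _, Complex.ofReal_sum,
    Finset.mul_sum]
  refine Finset.sum_congr rfl fun i hi => ?_
  rw [(hG k i hi).1, integral_const_mul, ← Complex.ofReal_natCast, ← Complex.ofReal_mul,
    ← Complex.ofReal_mul]
  congr 1
  have h1 := Real.Gamma_pos_of_pos (show 0 < p.β + 1 by linarith [p.β_pos])
  have h2 := Real.Gamma_pos_of_pos p.m_pos
  have h3 := Real.Gamma_pos_of_pos p.ms_pos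
  have h4 := Real.Gamma_pos_of_pos (add_pos p.m_pos p.ms_pos)
  have h5 := p.βSR_sub_δSR_pos
  rw [RelayParams.wSR, RelayParams.d, beta]
  -- Only the constants differ, and `Γ(m + ms)` from the Meijer evaluation cancels against `beta p.m
  -- p.ms`.
  generalize (∫ t in Set.Ioi (0 : ℝ), betaKer 0 (p.β + 1) t * (gamKer ((k : ℝ) - i) (p.rSR * t) *
    gamAverage i (lowerBeta p.m (p.m + p.ms)) (p.rSR * p.A * p.C * t))) = J
  field_simp

theorem IsRelayChannel.integral_N1 (hch : IsRelayChannel p P hSR hRU) :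
    ((∫ x in Set.Ioi (0 : ℝ), p.pdfSR x * distFun P (linkSNR p.gRU hRU) x / (1 + x) ^ p.β : ℝ) :
      ℂ) = p.closedN1 := by
  have hG := fun k => (p.meijerG2_N1 k p.rSR_pos p.A_pos).2
  have e : ∀ x ∈ Set.Ioi (0 : ℝ), ∑ k ∈ Finset.range p.Γs,
      p.wSR k * p.rSR ^ (k + 1) * (1 / beta p.m p.ms) * (betaKer k p.β x *
        (gamKer 0 (p.rSR * x) * lowerBeta p.m (p.m + p.ms) (p.A * x))) =
      p.pdfSR x * distFun P (linkSNR p.gRU hRU) x / (1 + x) ^ p.β := fun x (hx : 0 < x) => by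
    rw [hch.distFun_RU hx, p.pdfSR_eq, Finset.sum_mul, Finset.sum_div]
    refine Finset.sum_congr rfl fun k _ => ?_
    have := betaKer_mul_gamKer_nat (r := p.rSR) hx k p.β
    calc _ = p.wSR k * (1 / beta p.m p.ms) * lowerBeta p.m (p.m + p.ms) (p.A * x) *
        (p.rSR ^ (k + 1) * (betaKer k p.β x * gamKer 0 (p.rSR * x))) := by ring
      _ = _ := by rw [← this]; ring
  rw [← setIntegral_congr_fun measurableSet_Ioi e,
    integral_finsetSum _ fun k _ => (hG k).2.const_mul _, RelayParams.closedN1]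
  simp only [(hG _).1, ← Complex.ofReal_mul, ← Complex.ofReal_sum, integral_const_mul]
  congr 1
  refine Finset.sum_congr rfl fun k _ => ?_
  have h1 := Real.Gamma_pos_of_pos p.β_pos
  have h2 := Real.Gamma_pos_of_pos p.m_pos
  have h3 := Real.Gamma_pos_of_pos p.ms_pos
  have h4 := Real.Gamma_pos_of_pos (add_pos p.m_pos p.ms_pos)
  have h5 := p.gSR_pos
  rw [← p.gSR_wSR, beta]
  generalize (∫ t in Set.Ioi (0 : ℝ), betaKer k p.β t * (gamKer 0 (p.rSR * t) *
    lowerBeta p.m (p.m + p.ms) (p.A * t))) = J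
  field_simp

/-- The S-R distribution function splits into complete minus upper incomplete Gamma functions. The
complete part leaves Euler's integral for `hyp2F1`, the incomplete part the bivariate Meijer
function. -/
theorem IsRelayChannel.integral_N2 (hch : IsRelayChannel p P hSR hRU) :
    ((∫ x in Set.Ioi (0 : ℝ), p.pdfRU x * distFun P (linkSNR p.gSR hSR) x / (1 + x) ^ p.β : ℝ) :
      ℂ) = p.closedN2 := by
  have hβ := p.β_pos
  have hm := p.m_pos
  have hms := p.ms_pos
  have hA := p.A_pos
  have hG := fun k => (p.meijerG2_N2 k p.A_pos p.rSR_pos).2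
  have hI : IntegrableOn (fun t => betaKer (p.m - 1) p.β t * betaKer 0 (p.m + p.ms) (p.A * t))
      (Set.Ioi 0) := by
    obtain ⟨c, h6, h7⟩ := exists_between (show -p.m < min (p.β - p.m) 0 from
      lt_min (by linarith) (by linarith))
    rw [lt_min_iff] at h7
    exact (mellinRep_betaKer (b := p.m + p.ms) h7.2 (by linarith)).integrableOn_betaAverage
      (by linarith) (by linarith) hA
  have hF := hyp2F1_eq_integral (a := p.m + p.ms) (b := p.m) (c := p.m + p.ms + p.β) hA hm
    (by linarith)
  rw [add_sub_cancel_left, show p.m + p.ms + p.β - p.m = p.ms + p.β by ring] at hF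
  have e : ∀ x ∈ Set.Ioi (0 : ℝ), ∑ k ∈ Finset.range p.Γs, p.g k *
      (Real.Gamma (k + 1) * (betaKer (p.m - 1) p.β x * betaKer 0 (p.m + p.ms) (p.A * x)) -
        betaKer (p.m - 1) p.β x *
          (betaKer 0 (p.m + p.ms) (p.A * x) * upperGam (k + 1) (p.rSR * x))) =
      p.pdfRU x * distFun P (linkSNR p.gSR hSR) x / (1 + x) ^ p.β := fun x (hx : 0 < x) => by
    rw [hch.distFun_SR hx, p.pdfRU_eq hx, Finset.mul_sum, Finset.sum_div]
    refine Finset.sum_congr rfl fun k _ => ?_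
    have h1 : (0 : ℝ) ≤ 1 + x := by linarith
    have hk : x⁻¹ * betaKer p.m (p.m + p.ms) (p.A * x) / (1 + x) ^ p.β =
        p.A ^ p.m * (betaKer (p.m - 1) p.β x * betaKer 0 (p.m + p.ms) (p.A * x)) := by
      simp only [betaKer]
      rw [Real.rpow_zero, Real.mul_rpow hA.le hx.le, Real.rpow_sub_one hx.ne', Real.rpow_neg h1]
      ring
    calc _ = 1 / beta p.m p.ms * p.wSR k *
        (p.A ^ p.m * (betaKer (p.m - 1) p.β x * betaKer 0 (p.m + p.ms) (p.A * x))) *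
        (Real.Gamma (k + 1) - upperGam (k + 1) (p.rSR * x)) := by
          rw [RelayParams.g, RelayParams.wSR]; field_simp
      _ = _ := by rw [← hk]; ring
  have hi : ∀ k : ℕ, IntegrableOn (fun x => Real.Gamma (k + 1) *
      (betaKer (p.m - 1) p.β x * betaKer 0 (p.m + p.ms) (p.A * x)) -
        betaKer (p.m - 1) p.β x *
          (betaKer 0 (p.m + p.ms) (p.A * x) * upperGam (k + 1) (p.rSR * x))) (Set.Ioi 0) :=
    fun k => (hI.const_mul _).sub (hG k).2
  rw [← setIntegral_congr_fun measurableSet_Ioi e,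
    integral_finsetSum _ fun k _ => (hi k).const_mul _, RelayParams.closedN2]
  simp only [(hG _).1, ← Complex.ofReal_mul, ← Complex.ofReal_sum, ← Complex.ofReal_sub]
  congr 1
  refine Finset.sum_congr rfl fun k _ => ?_
  have h1 := Real.Gamma_pos_of_pos hβ
  have h4 := Real.Gamma_pos_of_pos (add_pos hm hms)
  rw [integral_const_mul, integral_sub (hI.const_mul _) (hG k).2, integral_const_mul, ← hF]
  congr 2
  · ring
  · generalize (∫ t in Set.Ioi (0 : ℝ), betaKer (p.m - 1) p.β t *
      (betaKer 0 (p.m + p.ms) (p.A * t) * upperGam (k + 1) (p.rSR * t))) = J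
    field_simp

end Channel

end

theorem mainTheorem2 {Ω : Type*} [MeasurableSpace Ω] (P : Measure Ω) [IsProbabilityMeasure P]
    (p : RelayParams) (hSR hRU : Ω → ℂ) (hch : IsRelayChannel p P hSR hRU) :
    -- the Meijer G-functions below are well defined
    p.AllConverge ∧
    -- `pdfSR` and `pdfRU` are the densities of the link SNRs
    P.map (linkSNR p.gSR hSR) = densityLaw p.pdfSR ∧
    P.map (linkSNR p.gRU hRU) = densityLaw p.pdfRU ∧
    -- effective capacity in terms of the normalized QoS exponent
    (∀ γ ∈ [linkSNR p.gSR hSR, linkSNR p.gRU hRU, snrAF p hSR hRU, snrDF p hSR hRU],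
      effectiveCapacity p P γ = -(1 / p.θ) * Real.log (∫ ω, (1 + γ ω) ^ (-p.β) ∂P)) ∧
    -- S-R link
    (effectiveCapacity p P (linkSNR p.gSR hSR) : ℂ) =
      -(1 / (p.θ : ℂ)) * Complex.log p.closedSR ∧
    -- R-U link
    (effectiveCapacity p P (linkSNR p.gRU hRU) : ℂ) =
      -(1 / (p.θ : ℂ)) * Complex.log p.closedRU ∧
    -- fixed-gain AF relay
    (effectiveCapacity p P (snrAF p hSR hRU) = -(1 / p.θ) * Real.log
      (p.β * ∫ x in Set.Ioi (0 : ℝ), distFun P (snrAF p hSR hRU) x / (1 + x) ^ (p.β + 1))) ∧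
    (IntegrableOn (fun x : ℝ => distFun P (linkSNR p.gSR hSR) x / (1 + x) ^ (p.β + 1))
        (Set.Ioi 0) ∧
      ((∫ x in Set.Ioi (0 : ℝ), distFun P (linkSNR p.gSR hSR) x / (1 + x) ^ (p.β + 1) : ℝ) : ℂ) =
        p.closedM1) ∧
    ((∀ x : ℝ, 0 < x → IntegrableOn (fun y : ℝ =>
        distFun P (linkSNR p.gRU hRU) (p.C * x / y) * p.pdfSR (y + x)) (Set.Ioi 0)) ∧
      IntegrableOn (fun x : ℝ => termL p P hRU x / (1 + x) ^ (p.β + 1)) (Set.Ioi 0) ∧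
      ((∫ x in Set.Ioi (0 : ℝ), termL p P hRU x / (1 + x) ^ (p.β + 1) : ℝ) : ℂ) =
        p.closedM2) ∧
    (effectiveCapacity p P (snrAF p hSR hRU) : ℂ) =
      -(1 / (p.θ : ℂ)) * Complex.log ((p.β : ℂ) * (p.closedM1 + p.closedM2)) ∧
    -- DF relay
    (IntegrableOn (fun x : ℝ => (p.pdfSR x + p.pdfRU x) / (1 + x) ^ p.β) (Set.Ioi 0) ∧
      ((∫ x in Set.Ioi (0 : ℝ), (p.pdfSR x + p.pdfRU x) / (1 + x) ^ p.β : ℝ) : ℂ) =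
        p.closedSR + p.closedRU) ∧
    (IntegrableOn (fun x : ℝ => p.pdfSR x * distFun P (linkSNR p.gRU hRU) x / (1 + x) ^ p.β)
        (Set.Ioi 0) ∧
      ((∫ x in Set.Ioi (0 : ℝ),
        p.pdfSR x * distFun P (linkSNR p.gRU hRU) x / (1 + x) ^ p.β : ℝ) : ℂ) = p.closedN1) ∧
    (IntegrableOn (fun x : ℝ => p.pdfRU x * distFun P (linkSNR p.gSR hSR) x / (1 + x) ^ p.β)
        (Set.Ioi 0) ∧
      ((∫ x in Set.Ioi (0 : ℝ),
        p.pdfRU x * distFun P (linkSNR p.gSR hSR) x / (1 + x) ^ p.β : ℝ) : ℂ) = p.closedN2) ∧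
    (effectiveCapacity p P (snrDF p hSR hRU) : ℂ) =
      -(1 / (p.θ : ℂ)) *
        Complex.log (p.closedSR + p.closedRU - p.closedN1 - p.closedN2) := by
  have hmX := measurable_linkSNR hch.measurable_SR p.gSR
  have hmY := measurable_linkSNR hch.measurable_RU p.gRU
  have hX0 := linkSNR_nonneg p.gSR_pos hSR
  have hY0 := linkSNR_nonneg p.gRU_pos hRU
  have hind : IndepFun (linkSNR p.gSR hSR) (linkSNR p.gRU hRU) P :=
    hch.indep.comp (φ := fun z => p.gSR * ‖z‖ ^ 2) (ψ := fun z => p.gRU * ‖z‖ ^ 2)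
      (by fun_prop) (by fun_prop)
  have hAF0 : ∀ ω, 0 ≤ snrAF p hSR hRU ω := fun ω =>
    div_nonneg (mul_nonneg (hX0 ω) (hY0 ω)) (add_nonneg (hY0 ω) p.C_pos.le)
  have hDF0 : ∀ ω, 0 ≤ snrDF p hSR hRU ω := fun ω => le_min (hX0 ω) (hY0 ω)
  have hmAF : Measurable (snrAF p hSR hRU) := (hmX.mul hmY).div (hmY.add_const _)
  have hβ := p.β_pos
  have hlX := hch.map_linkSNR_SR
  have hlY := hch.map_linkSNR_RU
  have hec : ∀ γ ∈ [linkSNR p.gSR hSR, linkSNR p.gRU hRU, snrAF p hSR hRU, snrDF p hSR hRU],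
      effectiveCapacity p P γ = -(1 / p.θ) * Real.log (∫ ω, (1 + γ ω) ^ (-p.β) ∂P) := by
    intro γ hγ
    refine effectiveCapacity_eq P p ?_
    simp only [List.mem_cons, List.not_mem_nil, or_false] at hγ
    rcases hγ with rfl | rfl | rfl | rfl <;> assumption
  -- The closed forms are complex expressions equal to a nonnegative real expectation, where the
  -- complex and real logarithms agree.
  have hlog : ∀ {γ : Ω → ℝ} {Z : ℂ}, (∀ ω, 0 ≤ γ ω) →
      ((∫ ω, (1 + γ ω) ^ (-p.β) ∂P : ℝ) : ℂ) = Z →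
      (effectiveCapacity p P γ : ℂ) = -(1 / (p.θ : ℂ)) * Complex.log Z := by
    intro γ Z h0 hZ
    rw [effectiveCapacity_eq P p h0, ← hZ, ← Complex.ofReal_log (integral_nonneg fun ω =>
      Real.rpow_nonneg (by linarith [h0 ω]) _)]
    push_cast
    rfl
  obtain ⟨iS, eS⟩ := integral_one_add_rpow_of_law hmX hβ p.measurable_pdfSR p.pdfSR_nonneg hlX
  obtain ⟨iU, eU⟩ := integral_one_add_rpow_of_law hmY hβ p.measurable_pdfRU p.pdfRU_nonneg hlY
  obtain ⟨iN1, eN1⟩ := integral_indicator_le hmX hmY hind hX0 hβ p.measurable_pdfSR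
    p.pdfSR_nonneg hlX
  obtain ⟨iN2, eN2⟩ := integral_indicator_le hmY hmX hind.symm hY0 hβ p.measurable_pdfRU
    p.pdfRU_nonneg hlY
  have hAF := fun x (hx : 0 < x) => distFun_mul_div_add hmX hmY hind hY0 p.C_pos
    p.measurable_pdfSR p.pdfSR_nonneg hlX hx
  have eAF := integral_one_add_rpow_eq (P := P) hmAF hAF0 hβ
  have eM : ∫ x in Set.Ioi (0 : ℝ), distFun P (snrAF p hSR hRU) x / (1 + x) ^ (p.β + 1) =
      (∫ x in Set.Ioi (0 : ℝ), distFun P (linkSNR p.gSR hSR) x / (1 + x) ^ (p.β + 1)) +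
        ∫ x in Set.Ioi (0 : ℝ), termL p P hRU x / (1 + x) ^ (p.β + 1) := by
    rw [← integral_add hch.integral_M1.1 hch.integral_M2.1]
    refine setIntegral_congr_fun measurableSet_Ioi fun x hx => ?_
    rw [← add_div]
    exact congrArg (· / (1 + x) ^ (p.β + 1)) (hAF x hx).2
  have eDF := integral_one_add_min_rpow hmX hmY hind hX0 hY0 hβ hlY
  have hw : 0 < p.rSR * p.A * p.C := mul_pos (mul_pos p.rSR_pos p.A_pos) p.C_pos
  refine ⟨⟨fun k _ => (meijerG_gamma_kernel k hβ p.rSR_pos).1,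
      (meijerG_beta_kernel p.m_pos p.ms_pos hβ p.A_pos).1,
      fun k _ => (meijerG_upperGam_kernel k hβ p.rSR_pos).1,
      fun k _ i hi => (p.meijerG2_M2 k i hi p.rSR_pos hw).1,
      fun k _ => (p.meijerG2_N1 k p.rSR_pos p.A_pos).1,
      fun k _ => (p.meijerG2_N2 k p.A_pos p.rSR_pos).1⟩, hlX, hlY, hec, ?_, ?_, ?_,
    hch.integral_M1, ⟨fun x hx => (hAF x hx).1, hch.integral_M2⟩, ?_, ⟨?_, ?_⟩,
    ⟨iN1, hch.integral_N1⟩, ⟨iN2, hch.integral_N2⟩, ?_⟩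
  · exact hlog hX0 (by rw [eS, p.integral_pdfSR_div])
  · exact hlog hY0 (by rw [eU, p.integral_pdfRU_div])
  · rw [effectiveCapacity_eq P p hAF0, eAF]
  · refine hlog hAF0 ?_
    rw [eAF, eM, Complex.ofReal_mul, Complex.ofReal_add, hch.integral_M1.2, hch.integral_M2.2]
  · simp only [add_div]
    exact iS.add iU
  · simp only [add_div]
    rw [integral_add iS iU, Complex.ofReal_add, p.integral_pdfSR_div, p.integral_pdfRU_div]
  · refine hlog hDF0 ?_
    simp only [snrDF]
    rw [eDF, eS, eU, eN1, eN2, Complex.ofReal_sub, Complex.ofReal_sub, Complex.ofReal_add,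
      p.integral_pdfSR_div, p.integral_pdfRU_div, hch.integral_N1, hch.integral_N2]
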